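/- Let $\alpha,\beta\ge 0$ be densities of finite mass supported on $\mathbb R_+$ such that all bimoments $\iint_{\mathbb R_+^2} x^iy^j\frac{\alpha(x)\beta(y)}{x+y}\,dx\,dy$ are finite. Let $p_j,q_j$ ($j\ge 0$) be the Cauchy biorthogonal polynomials: $\deg p_j=\deg q_j=j$, the leading coefficients of $p_j$ and $q_j$ are equal and positive, and $\iint_{\mathbb R_+^2} p_j(x)q_k(y)\frac{\alpha(x)\beta(y)}{x+y}\,dx\,dy=\delta_{jk}$. For $N\in\mathbb N$ and $x,x',y,y'>0$ define the kernels (those of the correlation functions of the Cauchy two-matrix model of size $N$) $$H_{00}(x,y)=\sum_{j=0}^{N-1}p_j(x)q_j(y),\qquad H_{01}(x,x')=\int_{\mathbb R_+} \frac{H_{00}(x,y)\,\beta(y)\,dy}{x'+y},\qquad H_{10}(y,y')=\int_{\mathbb R_+} \frac{H_{00}(x,y')\,\alpha(x)\,dx}{x+y},$$ $$H_{11}(y,x)=\iint_{\mathbb R_+^2} \frac{H_{00}(z,w)\,\alpha(z)\beta(w)\,dz\,dw}{(z+y)(x+w)}-\frac1{x+y}.$$ Put $p_j^{(0)}=p_j$,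 $q_j^{(0)}=q_j$, $p_j^{(1)}(z)=\int_{\mathbb R_+}\frac{p_j(\xi)\alpha(\xi)d\xi}{z-\xi}$, $q_j^{(1)}(w)=\int_{\mathbb R_+}\frac{q_j(\zeta)\beta(\zeta)d\zeta}{w-\zeta}$, and for $\mu,\nu\in\{0,1\}$ $$\mathbb H_{N,\mu\nu}(z,w)=\sum_{j=0}^{N-1}q_j^{(\mu)}(w)\,p_j^{(\nu)}(z)+\frac{\delta_{\mu1}\delta_{\nu1}}{z+w}.$$ Let $\beta^\star(x)=\beta(-x)$ and let $\widehat\Gamma$ be a solution of the following $3\times3$ Riemann–Hilbert problem: (1) $\widehat\Gamma$ is analytic on $\Omega=\mathbb C\setminus(\operatorname{supp}\alpha\cup\operatorname{supp}\beta^\star)$; (2) $\widehat\Gamma_+=\widehat\Gamma_-V$ on $\mathbb R$ with $$V=\begin{bmatrix}1&-2\pi i\,\alpha&0\\0&1&-2\pi i\,\beta^\star\\0&0&1\end{bmatrix},$$ in the weak sense: $\|\widehat\Gamma(z)\|\le C(1+|z|)^k(1+|\operatorname{Im}z|^{-1})^m$ off the real axis for some $C,k,m$, and $\int_{\mathbb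 R}\varphi(x)\big[\widehat\Gamma(x+i\varepsilon)-\widehat\Gamma(x-i\varepsilon)V(x)\big]dx\to0$ as $\varepsilon\downarrow0$ for every $\varphi\in C_c^\infty(\mathbb R)$; (3) $\widehat\Gamma(z)=\big(\mathbf 1+\mathcal O(1/z)\big)\operatorname{diag}(z^N,1,z^{-N})$ as $z\to\infty$ in each double sector $|\operatorname{Im} z|\ge\delta|z|$, $\delta>0$. Then for all $x,x',y,y'>0$ $$\begin{aligned} H_{00}(x,y)&=\mathbb H_{N,00}(x,y)=\frac{[\widehat\Gamma^{-1}(-y)\widehat\Gamma(x)]_{3,1}}{x+y},& H_{10}(y',y)&=-\mathbb H_{N,01}(-y',y)=\frac{[\widehat\Gamma^{-1}(-y)\widehat\Gamma(-y')]_{3,2}}{y'-y},\\ H_{01}(x,x')&=-\mathbb H_{N,10}(x,-x')=\frac{[\widehat\Gamma^{-1}(x')\widehat\Gamma(x)]_{2,1}}{x'-x},& H_{11}(y,x)&=\mathbb H_{N,11}(-y,-x)=-\frac{[\widehat\Gamma^{-1}(x)\widehat\Gamma(-y)]_{2,2}}{x+y}. \end{aligned}$$ Here each quotient, which is defined for pairs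 of distinct arguments of $\widehat\Gamma^{-1}$ and $\widehat\Gamma$ in $\Omega$, is understood as its limit from within such pairs when an argument lies on a support or when the two arguments coincide; these limits exist. -/

import Mathlib

open MeasureTheory Filter Topology Asymptotics Polynomial
open scoped ContDiff

namespace CauchyTwoMatrix

noncomputable section

/-- `α`, `β` are nonnegative densities of finite mass, supported on the positive half-line, for
which all bimoments with respect to the Cauchy kernel `1 / (x + y)` are finite. -/
structure IsDensityPair (α β : ℝ → ℝ) : Prop where
  nonneg_left : ∀ x, 0 ≤ α x
  nonneg_right : ∀ y, 0 ≤ β y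
  supp_left : ∀ x < 0, α x = 0
  supp_right : ∀ y < 0, β y = 0
  integrable_left : Integrable α
  integrable_right : Integrable β
  bimoments : ∀ i j : ℕ, Integrable
    (fun P : ℝ × ℝ => P.1 ^ i * P.2 ^ j / (P.1 + P.2) * (α P.1 * β P.2))

/-- The Cauchy biorthogonal polynomials: `p j` and `q j` have exact degree `j`, the same positive
leading coefficient, and are biorthonormal for `α(x) β(y) dx dy / (x + y)`. -/
structure IsCauchyBOP (α β : ℝ → ℝ) (p q : ℕ → ℝ[X]) : Prop where
  natDegree_left : ∀ j, (p j).natDegree = j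
  natDegree_right : ∀ j, (q j).natDegree = j
  leadingCoeff_pos : ∀ j, 0 < (p j).leadingCoeff
  leadingCoeff_eq : ∀ j, (p j).leadingCoeff = (q j).leadingCoeff
  biorthonormal : ∀ j k, ∫ x in Set.Ioi (0 : ℝ), ∫ y in Set.Ioi (0 : ℝ),
    (p j).eval x * (q k).eval y / (x + y) * (α x * β y) = if j = k then 1 else 0

/-! ### The kernels of the correlation functions -/

/-- `H₀₀(x, y) = 𝕂_N(x, y) = ∑_{j < N} p_j(x) q_j(y)`. -/
def H00 (p q : ℕ → ℝ[X]) (N : ℕ) (x y : ℝ) : ℝ :=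
  ∑ j ∈ Finset.range N, (p j).eval x * (q j).eval y

/-- `H₀₁(x, x') = ∫ H₀₀(x, y) β(y) dy / (x' + y)`. -/
def H01 (β : ℝ → ℝ) (p q : ℕ → ℝ[X]) (N : ℕ) (x x' : ℝ) : ℝ :=
  ∫ y in Set.Ioi (0 : ℝ), H00 p q N x y * β y / (x' + y)

/-- `H₁₀(y, y') = ∫ H₀₀(x, y') α(x) dx / (x + y)`. -/
def H10 (α : ℝ → ℝ) (p q : ℕ → ℝ[X]) (N : ℕ) (y y' : ℝ) : ℝ :=
  ∫ x in Set.Ioi (0 : ℝ), H00 p q N x y' * α x / (x + y)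

/-- `H₁₁(y, x) = ∬ H₀₀(z, w) α(z) dz β(w) dw / ((z + y) (x + w)) - 1 / (x + y)`. -/
def H11 (α β : ℝ → ℝ) (p q : ℕ → ℝ[X]) (N : ℕ) (y x : ℝ) : ℝ :=
  (∫ z in Set.Ioi (0 : ℝ), ∫ w in Set.Ioi (0 : ℝ),
    H00 p q N z w * (α z * β w) / ((z + y) * (x + w))) - 1 / (x + y)

/-! ### The Christoffel-Darboux matrix kernel -/

/-- For a polynomial `f` and a density `ρ`: `f^{(0)}(z) = f(z)` and
`f^{(1)}(z) = ∫ f(ξ) ρ(ξ) dξ / (z - ξ)`. -/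
def transform (ρ : ℝ → ℝ) (f : ℝ[X]) (μ : Fin 2) (z : ℂ) : ℂ :=
  match μ with
  | 0 => aeval z f
  | 1 => ∫ ξ in Set.Ioi (0 : ℝ), ((f.eval ξ * ρ ξ : ℝ) : ℂ) / (z - (ξ : ℂ))

/-- The principal `2 × 2` block (indices `μ, ν = 0, 1`) of the matrix kernel:
`ℍ_{N, μν}(z, w) = ∑_{j < N} q_j^{(μ)}(w) p_j^{(ν)}(z) + 𝔽_{μν} / (z + w)`, where the block of `𝔽`
is constant, with `𝔽₁₁ = 1` as its only nonzero entry. -/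
def matrixKernel (α β : ℝ → ℝ) (p q : ℕ → ℝ[X]) (N : ℕ) (z w : ℂ) : Matrix (Fin 2) (Fin 2) ℂ :=
  Matrix.of fun μ ν =>
    ∑ j ∈ Finset.range N, transform β (q j) μ w * transform α (p j) ν z
      + (!![0, 0; 0, 1] : Matrix (Fin 2) (Fin 2) ℂ) μ ν / (z + w)

/-! ### The Riemann-Hilbert problem -/

/-- The reflected density `ρ*(x) = ρ(-x)`. -/
def reflected (ρ : ℝ → ℝ) (x : ℝ) : ℝ := ρ (-x)

/-- `ℂ \ (supp α ∪ supp β*)`. -/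
def offSupports (α β : ℝ → ℝ) : Set ℂ :=
  ((fun t : ℝ => (t : ℂ)) '' (tsupport α ∪ tsupport (reflected β)))ᶜ

/-- The jump matrix on the real line: it is `1 - 2πi α E₁₂` on the positive and `1 - 2πi β* E₂₃` on
the negative half-line (and the identity off the supports). -/
def jumpMatrix (α β : ℝ → ℝ) (x : ℝ) : Matrix (Fin 3) (Fin 3) ℂ :=
  !![1, -2 * (Real.pi : ℂ) * Complex.I * (α x : ℂ), 0;
     0, 1, -2 * (Real.pi : ℂ) * Complex.I * (reflected β x : ℂ);
     0, 0, 1]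

/-- `Γ` solves the `3 × 3` Riemann-Hilbert problem with parameter `n`. For general densities
pointwise boundary values need not exist, so the jump relation `Γ₊ = Γ₋ V` is understood weakly,
against test functions, for functions of slow growth (the class of functions that have tempered
boundary values). The asymptotic relation `Γ(z) = (1 + O(1/z)) diag(zⁿ, 1, z⁻ⁿ)` is required
as `z → ∞` away from the real axis, i.e. in every double sector `|Im z| ≥ δ |z|`.
The values of `Γ` on the supports are irrelevant. -/
structure IsRHPSolution (α β : ℝ → ℝ) (n : ℕ) (Γ : ℂ → Matrix (Fin 3) (Fin 3) ℂ) : Prop where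
  analytic : ∀ i j, DifferentiableOn ℂ (fun z => Γ z i j) (offSupports α β)
  slowGrowth : ∃ (C : ℝ) (k m : ℕ), ∀ z : ℂ, z.im ≠ 0 → ∀ i j,
    ‖Γ z i j‖ ≤ C * (1 + ‖z‖) ^ k * (1 + |z.im|⁻¹) ^ m
  jump : ∀ φ : ℝ → ℂ, ContDiff ℝ ∞ φ → HasCompactSupport φ → ∀ i j,
    Tendsto
      (fun ε : ℝ => ∫ x : ℝ, φ x *
        (Γ ((x : ℂ) + (ε : ℂ) * Complex.I)
          - Γ ((x : ℂ) - (ε : ℂ) * Complex.I) * jumpMatrix α β x) i j)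
      (𝓝[>] 0) (𝓝 0)
  asymptotics : ∀ δ : ℝ, 0 < δ → ∀ i j,
    (fun z : ℂ => (Γ z * Matrix.diagonal ![(z ^ n)⁻¹, 1, z ^ n] - 1) i j)
      =O[Bornology.cobounded ℂ ⊓ 𝓟 {z : ℂ | δ * ‖z‖ ≤ |z.im|}] (fun z : ℂ => z⁻¹)

/-- `G(a, b) = L`, where `G` is defined at pairs of distinct points off the supports, and its value
at `(a, b)` is the common boundary value (limit from all sides) if `a` or `b` lies on a support, or
if `a = b`. When `a ≠ b` are both off the supports, this forces `G a b = L`. -/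
def HasValue (α β : ℝ → ℝ) (G : ℂ → ℂ → ℂ) (a b L : ℂ) : Prop :=
  Tendsto (fun P : ℂ × ℂ => G P.1 P.2)
    (𝓝[{P : ℂ × ℂ | P.1 ∈ offSupports α β ∧ P.2 ∈ offSupports α β ∧ P.1 ≠ P.2}] (a, b)) (𝓝 L)

end

end CauchyTwoMatrix

/-!
The idea is to solve the Riemann-Hilbert problem explicitly. A function which is analytic off the
real line, grows slowly there and has no weak jump is a polynomial: its convolutions along the line
with test functions extend continuously across the line, because each pair of derivatives falling on
the test function lowers the order of growth, so Liouville's theorem applies. Subtracting Cauchy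
transforms, the first column of `Γ` is thus a vector `P` of polynomials, the second is the Cauchy
transform of `P α` up to a constant vector, and the third is that of the second column times `β*` up
to polynomials.

With this normalization `det Γ = 1`, and the rows of `Γ⁻¹` are the cross products of the columns. In
particular the third row `W` is polynomial. It annihilates the first two columns and has product `1`
with the third, and this makes `W(w) · P(z) / (z - w)` a polynomial in `z` of degree less than `N`
which reproduces polynomials of degree less than `N` under the Cauchy pairing. Hence it equals
`∑ q_j(-w) p_j(z)`. Taking Cauchy transforms in `z` and in `w` gives the other entries, and the four
kernels are continuous at the points in question, so that the quotients have limits there.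
-/

namespace CauchyTwoMatrix

noncomputable section

open Complex (I)
open scoped Matrix

/-! ### Functions of slow growth without jump -/

/-- The complement of the real line in `ℂ`. -/
def offReal : Set ℂ := {z | z.im ≠ 0}

/-- `f` grows at most like `‖z‖ ^ k` at infinity and like `|Im z| ^ (-m)` at the real line. -/
def HasSlowGrowth (f : ℂ → ℂ) (k m : ℕ) : Prop :=
  ∃ A : ℝ, 0 ≤ A ∧ ∀ z ∈ offReal, ‖f z‖ ≤ A * (1 + ‖z‖) ^ k * (1 + |z.im|⁻¹) ^ m

/-- Smooth compactly supported functions on the line. -/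
structure IsTestFunction (φ : ℝ → ℂ) : Prop where
  contDiff : ContDiff ℝ ∞ φ
  hasCompactSupport : HasCompactSupport φ

/-- The weak form of the jump relation `f₊ - f₋ = ρ` on the real line. -/
def HasWeakJump (f : ℂ → ℂ) (ρ : ℝ → ℂ) : Prop :=
  ∀ φ : ℝ → ℂ, IsTestFunction φ →
    Tendsto (fun ε : ℝ => ∫ x : ℝ, φ x * (f (x + ε * I) - f (x - ε * I))) (𝓝[>] 0)
      (𝓝 (∫ x, φ x * ρ x))

/-- The convolution of `f` with `φ` along the real direction. -/
def smear (φ : ℝ → ℂ) (f : ℂ → ℂ) (z : ℂ) : ℂ := ∫ t : ℝ, φ t * f (z - t)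

theorem isOpen_offReal : IsOpen offReal :=
  isOpen_ne_fun Complex.continuous_im continuous_const

theorem dense_offReal : Dense offReal := by
  have : offReal = (Complex.im ⁻¹' {0})ᶜ := rfl
  rw [this, ← interior_eq_empty_iff_dense_compl, Complex.interior_preimage_im]
  simp

theorem sub_ofReal_mem_offReal {z : ℂ} (hz : z ∈ offReal) (t : ℝ) : z - t ∈ offReal := by
  simpa [offReal] using hz

theorem ofReal_add_mul_I_mem_offReal (x : ℝ) {ε : ℝ} (hε : ε ≠ 0) : (x : ℂ) + ε * I ∈ offReal := by
  simpa [offReal] using hε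

theorem ofReal_sub_mul_I_mem_offReal (x : ℝ) {ε : ℝ} (hε : ε ≠ 0) : (x : ℂ) - ε * I ∈ offReal := by
  simpa [offReal] using hε

theorem IsTestFunction.continuous {φ : ℝ → ℂ} (hφ : IsTestFunction φ) : Continuous φ :=
  hφ.contDiff.continuous

theorem IsTestFunction.deriv {φ : ℝ → ℂ} (hφ : IsTestFunction φ) : IsTestFunction (deriv φ) :=
  ⟨(contDiff_infty_iff_deriv.1 hφ.contDiff).2, hφ.hasCompactSupport.deriv⟩

theorem IsTestFunction.comp_sub_left {φ : ℝ → ℂ} (hφ : IsTestFunction φ) (x : ℝ) :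
    IsTestFunction fun u => φ (x - u) :=
  ⟨hφ.contDiff.comp (contDiff_const.sub contDiff_id),
    hφ.hasCompactSupport.comp_homeomorph (Homeomorph.subLeft x)⟩

section Smear

variable {f : ℂ → ℂ} {φ : ℝ → ℂ} {k m : ℕ}

theorem integrable_mul_comp_sub (hφ : Continuous φ) (hc : HasCompactSupport φ)
    (hf : ContinuousOn f offReal) {z : ℂ} (hz : z ∈ offReal) :
    Integrable fun t : ℝ => φ t * f (z - t) :=
  (hφ.mul (hf.comp_continuous (by fun_prop) (sub_ofReal_mem_offReal hz))
    ).integrable_of_hasCompactSupport hc.mul_right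

theorem hasDerivAt_smear (hf : DifferentiableOn ℂ f offReal) (hφ : Continuous φ)
    (hc : HasCompactSupport φ) {z : ℂ} (hz : z ∈ offReal) :
    HasDerivAt (smear φ f) (smear φ (deriv f) z) z := by
  have hf' : ContinuousOn (deriv f) offReal := (hf.deriv isOpen_offReal).continuousOn
  obtain ⟨r, hr, hball⟩ := Metric.nhds_basis_closedBall.mem_iff.1 (isOpen_offReal.mem_nhds hz)
  obtain ⟨M, hM⟩ : ∃ M, ∀ P ∈ Metric.closedBall z r ×ˢ tsupport φ, ‖deriv f (P.1 - P.2)‖ ≤ M :=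
    ((isCompact_closedBall z r).prod hc).exists_bound_of_continuousOn
      (hf'.comp (by fun_prop) fun P hP => sub_ofReal_mem_offReal (hball hP.1) P.2)
  refine (hasDerivAt_integral_of_dominated_loc_of_deriv_le (bound := fun t => ‖φ t‖ * M)
    (F' := fun w t => φ t * deriv f (w - t)) (Metric.closedBall_mem_nhds z hr) ?_
    (integrable_mul_comp_sub hφ hc hf.continuousOn hz)
    (integrable_mul_comp_sub hφ hc hf' hz).aestronglyMeasurable
    (.of_forall fun t w hw => ?_)
    ((hφ.integrable_of_hasCompactSupport hc).norm.mul_const M) (.of_forall fun t w hw => ?_)).2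
  · filter_upwards [Metric.closedBall_mem_nhds z hr] with w hw
    exact (integrable_mul_comp_sub hφ hc hf.continuousOn (hball hw)).aestronglyMeasurable
  · rw [norm_mul]
    by_cases ht : t ∈ tsupport φ
    · gcongr
      exact hM (w, t) ⟨hw, ht⟩
    · simp [image_eq_zero_of_notMem_tsupport ht]
  · have hmem := isOpen_offReal.mem_nhds (sub_ofReal_mem_offReal (hball hw) t)
    exact ((hf.differentiableAt hmem).hasDerivAt.comp_sub_const w (t : ℂ)).const_mul (φ t)

theorem smear_deriv_right (hf : DifferentiableOn ℂ f offReal) (hφ : IsTestFunction φ) {z : ℂ}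
    (hz : z ∈ offReal) : smear φ (deriv f) z = smear (deriv φ) f z := by
  have hcont := hφ.continuous
  have hcs := hφ.hasCompactSupport
  have hint := integrable_mul_comp_sub hcont hcs (hf.deriv isOpen_offReal).continuousOn hz
  have hderiv (t : ℝ) : HasDerivAt (fun t : ℝ => f (z - t)) (-deriv f (z - t)) t := by
    have hmem := isOpen_offReal.mem_nhds (sub_ofReal_mem_offReal hz t)
    simpa using! (hf.differentiableAt hmem).hasDerivAt.comp t
      (Complex.ofRealCLM.hasDerivAt.const_sub z)
  have hparts := integral_mul_deriv_eq_deriv_mul_of_integrable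
    (fun t _ => (hφ.contDiff.differentiable (by simp) t).hasDerivAt) (fun t _ => hderiv t)
    (by simpa [Pi.mul_def] using! hint.neg)
    (integrable_mul_comp_sub hφ.deriv.continuous hφ.deriv.hasCompactSupport hf.continuousOn hz)
    (integrable_mul_comp_sub hcont hcs hf.continuousOn hz)
  simpa only [smear, mul_neg, integral_neg, neg_inj] using hparts

theorem hasDerivAt_smear_deriv_left (hf : DifferentiableOn ℂ f offReal) (hφ : IsTestFunction φ)
    {z : ℂ} (hz : z ∈ offReal) : HasDerivAt (smear φ f) (smear (deriv φ) f z) z :=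
  smear_deriv_right hf hφ hz ▸ hasDerivAt_smear hf hφ.continuous hφ.hasCompactSupport hz

theorem hasSlowGrowth_smear (hf : HasSlowGrowth f k m) (hφ : Continuous φ)
    (hc : HasCompactSupport φ) : HasSlowGrowth (smear φ f) k m := by
  obtain ⟨A, hA, hbound⟩ := hf
  obtain ⟨T, hT0, hT⟩ : ∃ T : ℝ, 0 ≤ T ∧ ∀ t ∈ tsupport φ, |t| ≤ T := by
    obtain ⟨T, hT⟩ := IsCompact.exists_bound_of_continuousOn hc continuousOn_id
    exact ⟨max T 0, le_max_right _ _, fun t ht => (hT t ht).trans (le_max_left _ _)⟩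
  refine ⟨A * (1 + T) ^ k * ∫ t, ‖φ t‖, by positivity, fun z hz => ?_⟩
  have hpt (t : ℝ) : ‖φ t * f (z - t)‖ ≤
      ‖φ t‖ * (A * ((1 + T) * (1 + ‖z‖)) ^ k * (1 + |z.im|⁻¹) ^ m) := by
    rw [norm_mul]
    by_cases ht : t ∈ tsupport φ
    · have hnorm : 1 + ‖z - t‖ ≤ (1 + T) * (1 + ‖z‖) := by
        have hzt : ‖z - t‖ ≤ ‖z‖ + |t| := by simpa using norm_sub_le z (t : ℂ)
        nlinarith [hT t ht, norm_nonneg z]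
      have hzt := hbound (z - t) (sub_ofReal_mem_offReal hz t)
      rw [Complex.sub_im, Complex.ofReal_im, sub_zero] at hzt
      gcongr
      exact hzt.trans (by gcongr)
    · simp [image_eq_zero_of_notMem_tsupport ht]
  calc ‖smear φ f z‖
      ≤ ∫ t, ‖φ t‖ * (A * ((1 + T) * (1 + ‖z‖)) ^ k * (1 + |z.im|⁻¹) ^ m) :=
        norm_integral_le_of_norm_le ((hφ.integrable_of_hasCompactSupport hc).norm.mul_const _)
          (.of_forall hpt)
    _ = _ := by rw [integral_mul_const, mul_pow]; ring

/-- First order Taylor expansion at `z + c`, with the remainder in integral form. -/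
theorem norm_le_norm_add_norm_add_of_hasDerivAt {h h' h'' : ℂ → ℂ} {z c : ℂ} {B : ℝ}
    (hc : ‖c‖ = 1) (hh : ∀ t ∈ Set.Icc (0 : ℝ) 1, HasDerivAt h (h' (z + t * c)) (z + t * c))
    (hh' : ∀ t ∈ Set.Icc (0 : ℝ) 1, HasDerivAt h' (h'' (z + t * c)) (z + t * c))
    (hB : ∀ t ∈ Set.Icc (0 : ℝ) 1, t * ‖h'' (z + t * c)‖ ≤ B) :
    ‖h z‖ ≤ ‖h (z + c)‖ + ‖h' (z + c)‖ + B := by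
  set g : ℝ → ℂ := fun t => h (z + t * c) - t * c * h' (z + t * c) with hg
  have hpath (t : ℝ) : HasDerivAt (fun t : ℝ => z + t * c) c t := by
    simpa using (Complex.ofRealCLM.hasDerivAt.mul_const c).const_add z
  have hlin (t : ℝ) : HasDerivAt (fun t : ℝ => (t : ℂ) * c) c t := by
    simpa using Complex.ofRealCLM.hasDerivAt.mul_const c
  have hg' : ∀ t ∈ Set.Icc (0 : ℝ) 1, HasDerivAt g (-(t * c ^ 2 * h'' (z + t * c))) t := by
    intro t ht
    convert! ((hh t ht).comp t (hpath t)).sub ((hlin t).mul ((hh' t ht).comp t (hpath t))) using 1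
    simp only [Function.comp_apply]
    ring
  have hdiff : ‖g 1 - g 0‖ ≤ B := by
    refine norm_image_sub_le_of_norm_deriv_le_segment_01' (fun t ht => (hg' t ht).hasDerivWithinAt)
      fun t ht => ?_
    simpa [hc, abs_of_nonneg ht.1] using hB t (Set.Ico_subset_Icc_self ht)
  have hg0 : g 0 = h z := by simp [hg]
  have hg1 : ‖g 1‖ ≤ ‖h (z + c)‖ + ‖h' (z + c)‖ := by
    simpa [hg, hc] using norm_sub_le (h (z + c)) (c * h' (z + c))
  rw [← hg0]
  linarith [norm_sub_norm_le (g 0) (g 1), norm_sub_rev (g 0) (g 1)]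

theorem exists_vertical_direction (z : ℂ) :
    ∃ c : ℂ, ‖c‖ = 1 ∧ ∀ t : ℝ, 0 ≤ t → |(z + t * c).im| = |z.im| + t := by
  rcases lt_or_ge z.im 0 with h | h
  · exact ⟨-I, by simp, fun t ht => by
      simp [abs_of_neg h, abs_of_neg (show z.im + -t < 0 by linarith)]; ring⟩
  · exact ⟨I, by simp, fun t ht => by
      simp [abs_of_nonneg h, abs_of_nonneg (show 0 ≤ z.im + t by linarith)]⟩

theorem one_add_norm_add_ofReal_mul_le {z c : ℂ} (hc : ‖c‖ = 1) {t : ℝ}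
    (ht : t ∈ Set.Icc (0 : ℝ) 1) : 1 + ‖z + t * c‖ ≤ 2 * (1 + ‖z‖) := by
  have : ‖z + t * c‖ ≤ ‖z‖ + t := by simpa [hc, abs_of_nonneg ht.1] using norm_add_le z (t * c)
  linarith [ht.2, norm_nonneg z]

theorem mul_one_add_inv_pow_succ_le {t y y' : ℝ} (ht : t ∈ Set.Icc (0 : ℝ) 1) (hy : 0 < y)
    (hy' : y' = y + t) (m : ℕ) : t * (1 + y'⁻¹) ^ (m + 1) ≤ 2 * (1 + y⁻¹) ^ m := by
  have hle : y ≤ y' := by linarith [ht.1]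
  have hpos : 0 < y' := hy.trans_le hle
  have hcancel : t * (1 + y'⁻¹) ≤ 2 := by
    have := mul_inv_le_one_of_le₀ (show t ≤ y' by linarith) hpos.le
    linarith [ht.2]
  calc t * (1 + y'⁻¹) ^ (m + 1) = t * (1 + y'⁻¹) * (1 + y'⁻¹) ^ m := by ring
    _ ≤ 2 * (1 + y⁻¹) ^ m := by gcongr

/-- A second derivative gains one order at the real line: along the vertical segment from `z` away
from the line, the weight `t` in Taylor's remainder cancels one factor `|Im|⁻¹`. -/
theorem HasSlowGrowth.of_hasDerivAt_of_hasDerivAt {h h' h'' : ℂ → ℂ}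
    (hh : ∀ z ∈ offReal, HasDerivAt h (h' z) z) (hh' : ∀ z ∈ offReal, HasDerivAt h' (h'' z) z)
    (hb : HasSlowGrowth h k (m + 1)) (hb' : HasSlowGrowth h' k (m + 1))
    (hb'' : HasSlowGrowth h'' k (m + 1)) : HasSlowGrowth h k m := by
  obtain ⟨A₀, hA₀, hb₀⟩ := hb
  obtain ⟨A₁, hA₁, hb₁⟩ := hb'
  obtain ⟨A₂, hA₂, hb₂⟩ := hb''
  refine ⟨((A₀ + A₁) * 2 ^ (m + 1) + 2 * A₂) * 2 ^ k, by positivity, fun z hz => ?_⟩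
  obtain ⟨c, hc, him⟩ := exists_vertical_direction z
  have hz0 : 0 < |z.im| := abs_pos.2 hz
  have hmem (t : ℝ) (ht : t ∈ Set.Icc (0 : ℝ) 1) : z + t * c ∈ offReal :=
    abs_pos.1 (by linarith [him t ht.1, ht.1])
  have hmem1 : z + c ∈ offReal := by simpa using hmem 1 (by simp)
  have hend : (1 + ‖z + c‖) ^ k * (1 + |(z + c).im|⁻¹) ^ (m + 1) ≤
      (2 * (1 + ‖z‖)) ^ k * 2 ^ (m + 1) := by
    have hone : |(z + c).im| = |z.im| + 1 := by simpa using him 1 zero_le_one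
    have hinv : 1 + |(z + c).im|⁻¹ ≤ 2 := by
      linarith [inv_le_one_of_one_le₀ (show 1 ≤ |(z + c).im| by linarith)]
    gcongr
    simpa using one_add_norm_add_ofReal_mul_le (z := z) hc (t := 1) (by simp)
  have hremainder (t : ℝ) (ht : t ∈ Set.Icc (0 : ℝ) 1) : t * ‖h'' (z + t * c)‖ ≤
      A₂ * (2 * (1 + ‖z‖)) ^ k * (2 * (1 + |z.im|⁻¹) ^ m) := calc
    _ ≤ t * (A₂ * (1 + ‖z + t * c‖) ^ k * (1 + |(z + t * c).im|⁻¹) ^ (m + 1)) :=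
        mul_le_mul_of_nonneg_left (hb₂ _ (hmem t ht)) ht.1
    _ = A₂ * (1 + ‖z + t * c‖) ^ k * (t * (1 + |(z + t * c).im|⁻¹) ^ (m + 1)) := by ring
    _ ≤ _ := by
        gcongr A₂ * ?_ ^ k * ?_
        · exact mul_nonneg ht.1 (by positivity)
        · exact one_add_norm_add_ofReal_mul_le hc ht
        · exact mul_one_add_inv_pow_succ_le ht hz0 (him t ht.1) m
  have htaylor := norm_le_norm_add_norm_add_of_hasDerivAt hc (fun t ht => hh _ (hmem t ht))
    (fun t ht => hh' _ (hmem t ht)) hremainder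
  have hw : (1 : ℝ) ≤ (1 + |z.im|⁻¹) ^ m := one_le_pow₀ (by simp)
  calc ‖h z‖ ≤ (A₀ + A₁) * ((1 + ‖z + c‖) ^ k * (1 + |(z + c).im|⁻¹) ^ (m + 1)) * 1 +
          A₂ * (2 * (1 + ‖z‖)) ^ k * (2 * (1 + |z.im|⁻¹) ^ m) := by
        linarith [hb₀ _ hmem1, hb₁ _ hmem1]
    _ ≤ (A₀ + A₁) * ((2 * (1 + ‖z‖)) ^ k * 2 ^ (m + 1)) * (1 + |z.im|⁻¹) ^ m +
          A₂ * (2 * (1 + ‖z‖)) ^ k * (2 * (1 + |z.im|⁻¹) ^ m) := by gcongr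
    _ = _ := by rw [mul_pow]; ring

theorem hasSlowGrowth_smear_zero (hf : DifferentiableOn ℂ f offReal) (hb : HasSlowGrowth f k m)
    (hφ : IsTestFunction φ) : HasSlowGrowth (smear φ f) k 0 := by
  have hm (φ : ℝ → ℂ) (hφ : IsTestFunction φ) : HasSlowGrowth (smear φ f) k m :=
    hasSlowGrowth_smear hb hφ.continuous hφ.hasCompactSupport
  clear hb
  induction m generalizing φ with
  | zero => exact hm φ hφ
  | succ m ih =>
    refine ih hφ fun φ hφ => .of_hasDerivAt_of_hasDerivAt
      (fun z hz => hasDerivAt_smear_deriv_left hf hφ hz)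
      (fun z hz => hasDerivAt_smear_deriv_left hf hφ.deriv hz)
      (hm φ hφ) (hm _ hφ.deriv) (hm _ hφ.deriv.deriv)

end Smear

section WeakJump

variable {f h h' : ℂ → ℂ} {ρ : ℝ → ℂ} {φ : ℝ → ℂ} {k m : ℕ}

theorem smear_ofReal_add (φ : ℝ → ℂ) (f : ℂ → ℂ) (x : ℝ) (a : ℂ) :
    smear φ f (x + a) = ∫ u : ℝ, φ (x - u) * f (u + a) := by
  rw [smear, ← integral_sub_left_eq_self _ volume x]
  congr! 4 with u
  push_cast
  ring

theorem tendsto_smear_sub_smear (hf : ContinuousOn f offReal) (hj : HasWeakJump f ρ)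
    (hφ : IsTestFunction φ) (x : ℝ) :
    Tendsto (fun ε : ℝ => smear φ f (x + ε * I) - smear φ f (x - ε * I)) (𝓝[>] 0)
      (𝓝 (∫ u, φ (x - u) * ρ u)) := by
  have hφx := hφ.comp_sub_left x
  have hint {a : ℂ} (ha : a ∈ offReal) : Integrable fun u : ℝ => φ (x - u) * f (u + a) :=
    (hφx.continuous.mul (hf.comp_continuous (by fun_prop) fun u => by simpa [offReal] using ha)
      ).integrable_of_hasCompactSupport hφx.hasCompactSupport.mul_right
  refine (hj _ hφx).congr' ?_
  filter_upwards [self_mem_nhdsWithin] with ε (hε : 0 < ε)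
  have hplus : (ε * I : ℂ) ∈ offReal := by simpa [offReal] using hε.ne'
  have hminus : -(ε * I : ℂ) ∈ offReal := by simpa [offReal] using hε.ne'
  rw [sub_eq_add_neg (x : ℂ), smear_ofReal_add, smear_ofReal_add,
    ← integral_sub (hint hplus) (hint hminus)]
  simp only [mul_sub, sub_eq_add_neg (_ : ℂ) (ε * I)]

theorem exists_tendsto_nhdsWithin_of_convex {S : Set ℂ} {L : ℝ} (hS : Convex ℝ S)
    (hd : ∀ z ∈ S, HasDerivAt h (h' z) z) (hb : ∀ z ∈ S, ‖h' z‖ ≤ L) {x : ℂ}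
    (hx : x ∈ closure S) : ∃ y, Tendsto h (𝓝[S] x) (𝓝 y) := by
  have hlip : LipschitzOnWith L.toNNReal h S :=
    hS.lipschitzOnWith_of_nnnorm_hasDerivWithin_le (fun z hz => (hd z hz).hasDerivWithinAt)
      fun z hz => NNReal.coe_le_coe.1 ((hb z hz).trans (Real.le_coe_toNNReal L))
  have : (𝓝[S] x).NeBot := mem_closure_iff_nhdsWithin_neBot.1 hx
  exact cauchy_map_iff_exists_tendsto.1 ((cauchy_nhds.mono nhdsWithin_le_nhds).map_of_le
    hlip.uniformContinuousOn inf_le_right)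

theorem tendsto_ofReal_add_mul_nhdsGT {S : Set ℂ} (x : ℝ) (c : ℂ)
    (hS : ∀ ε : ℝ, 0 < ε → (x : ℂ) + ε * c ∈ S) :
    Tendsto (fun ε : ℝ => (x : ℂ) + ε * c) (𝓝[>] 0) (𝓝[S] (x : ℂ)) := by
  refine tendsto_nhdsWithin_iff.2 ⟨tendsto_nhdsWithin_of_tendsto_nhds ?_, ?_⟩
  · exact Continuous.tendsto' (by fun_prop) _ _ (by simp)
  · filter_upwards [self_mem_nhdsWithin] with ε hε using hS ε hε

theorem exists_tendsto_nhdsWithin_of_subset_offReal (hb : HasSlowGrowth h' k 0)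
    (hd : ∀ z ∈ offReal, HasDerivAt h (h' z) z) {S : Set ℂ} (hS : Convex ℝ S)
    (hSo : S ⊆ offReal) {x : ℂ} (hx : x ∈ closure S) : ∃ y, Tendsto h (𝓝[S] x) (𝓝 y) := by
  obtain ⟨A, hA, hA'⟩ := hb
  have hball : Metric.ball x 1 ∈ 𝓝 x := Metric.ball_mem_nhds x one_pos
  rw [nhdsWithin_eq_nhdsWithin' hball
    (show S ∩ Metric.ball x 1 = (S ∩ Metric.ball x 1) ∩ Metric.ball x 1 by simp [Set.inter_assoc])]
  refine exists_tendsto_nhdsWithin_of_convex (L := A * (2 + ‖x‖) ^ k)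
    (hS.inter (convex_ball x 1)) (fun z hz => hd z (hSo hz.1)) (fun z hz => ?_) ?_
  · have hzx : ‖z‖ ≤ ‖x‖ + ‖z - x‖ := by simpa using norm_add_le x (z - x)
    have hzx' : ‖z - x‖ < 1 := mem_ball_iff_norm.1 hz.2
    calc ‖h' z‖ ≤ A * (1 + ‖z‖) ^ k := by simpa using hA' z (hSo hz.1)
      _ ≤ A * (2 + ‖x‖) ^ k := by gcongr ?_ * ?_ ^ k; linarith
  · rw [mem_closure_iff_nhdsWithin_neBot] at hx ⊢
    rwa [nhdsWithin_inter_of_mem' (mem_nhdsWithin_of_mem_nhds hball)]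

/-- The bound on the derivative gives one limit from each half-plane, and the jump relation
identifies the two. -/
theorem exists_tendsto_nhdsWithin_offReal (hd : ∀ z ∈ offReal, HasDerivAt h (h' z) z)
    (hb : HasSlowGrowth h' k 0)
    (hj : ∀ x : ℝ, Tendsto (fun ε : ℝ => h (x + ε * I) - h (x - ε * I)) (𝓝[>] 0) (𝓝 0)) (z : ℂ) :
    ∃ y, Tendsto h (𝓝[offReal] z) (𝓝 y) := by
  by_cases hz : z ∈ offReal
  · exact ⟨h z, (hd z hz).continuousAt.continuousWithinAt⟩
  obtain ⟨x, rfl⟩ : ∃ x : ℝ, (x : ℂ) = z :=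
    ⟨z.re, Complex.ext rfl (by simpa [offReal, eq_comm] using hz)⟩
  have hup : Tendsto (fun ε : ℝ => (x : ℂ) + ε * I) (𝓝[>] 0) (𝓝[{z | 0 < z.im}] (x : ℂ)) :=
    tendsto_ofReal_add_mul_nhdsGT x I fun ε hε => by simpa using hε
  have hdown : Tendsto (fun ε : ℝ => (x : ℂ) - ε * I) (𝓝[>] 0) (𝓝[{z | z.im < 0}] (x : ℂ)) := by
    simpa [← sub_eq_add_neg] using
      tendsto_ofReal_add_mul_nhdsGT (S := {z | z.im < 0}) x (-I) fun ε hε => by simpa using hε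
  obtain ⟨y, hy⟩ := exists_tendsto_nhdsWithin_of_subset_offReal hb hd (convex_halfSpace_im_gt 0)
    (fun w hw => ne_of_gt hw) (mem_closure_iff_nhdsWithin_neBot.2 hup.neBot)
  obtain ⟨y', hy'⟩ := exists_tendsto_nhdsWithin_of_subset_offReal hb hd (convex_halfSpace_im_lt 0)
    (fun w hw => ne_of_lt hw) (mem_closure_iff_nhdsWithin_neBot.2 hdown.neBot)
  have heq : y = y' :=
    sub_eq_zero.1 (tendsto_nhds_unique ((hy.comp hup).sub (hy'.comp hdown)) (hj x))
  have hunion : offReal = {z | z.im < 0} ∪ {z | 0 < z.im} := by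
    ext w
    exact ne_iff_lt_or_gt
  exact ⟨y, by rw [hunion, nhdsWithin_union]; exact (heq ▸ hy').sup hy⟩

theorem differentiable_of_differentiableOn_offReal (hc : Continuous f)
    (hd : DifferentiableOn ℂ f offReal) : Differentiable ℂ f := by
  have hrect (z w : ℂ)
      (hzw : Set.Ioo (min z.im w.im) (max z.im w.im) ⊆ {0}ᶜ) :=
    Complex.integral_boundary_rect_eq_zero_of_continuousOn_of_differentiableOn f z w
      hc.continuousOn (hd.mono fun u hu => hzw hu.2)
  have hcons : Complex.IsConservativeOn f Set.univ := by
    intro z w _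
    rw [← add_eq_zero_iff_eq_neg, Complex.wedgeIntegral_add_wedgeIntegral_eq]
    -- cut the rectangle along the real axis
    have hlower := hrect z ⟨w.re, 0⟩ (by simp +contextual [Set.subset_def]; grind)
    have hupper := hrect ⟨z.re, 0⟩ w (by simp +contextual [Set.subset_def]; grind)
    have hint (x a b : ℝ) : IntervalIntegrable (fun y : ℝ => f (x + y * I)) volume a b :=
      (hc.comp (by fun_prop)).intervalIntegrable _ _
    rw [← intervalIntegral.integral_add_adjacent_intervals (hint w.re z.im 0) (hint w.re 0 w.im),
      ← intervalIntegral.integral_add_adjacent_intervals (hint z.re z.im 0) (hint z.re 0 w.im)]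
    simp only [smul_eq_mul] at hlower hupper ⊢
    linear_combination hlower + hupper
  exact differentiableOn_univ.1 ((hcons.isExactOn_univ hc).differentiableOn isOpen_univ)

theorem iteratedDeriv_eq_zero_of_norm_le (hf : Differentiable ℂ f) {A : ℝ}
    (hb : ∀ z, ‖f z‖ ≤ A * (1 + ‖z‖) ^ k) {n : ℕ} (hn : k < n) : iteratedDeriv n f 0 = 0 := by
  have hA : 0 ≤ A := by simpa using (norm_nonneg _).trans (hb 0)
  refine norm_le_zero_iff.1 (ge_of_tendsto
    (tendsto_const_nhds.div_atTop tendsto_id : Tendsto (fun R : ℝ => n.factorial * A * 2 ^ k / R)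
      atTop (𝓝 0)) ?_)
  filter_upwards [eventually_ge_atTop 1] with R hR
  have hR0 : 0 < R := by linarith
  calc ‖iteratedDeriv n f 0‖ ≤ n.factorial * (A * (1 + R) ^ k) / R ^ n :=
        Complex.norm_iteratedDeriv_le_of_forall_mem_sphere_norm_le n hR0 hf.diffContOnCl
          fun z hz => by simpa only [mem_sphere_zero_iff_norm.1 hz] using hb z
    _ ≤ n.factorial * (A * (2 * R) ^ k) / R ^ (k + 1) := by
        gcongr
        · linarith
        · exact hn
    _ = n.factorial * A * 2 ^ k / R := by rw [mul_pow, pow_succ]; field_simp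

theorem exists_polynomial_of_norm_le (hf : Differentiable ℂ f) {A : ℝ}
    (hb : ∀ z, ‖f z‖ ≤ A * (1 + ‖z‖) ^ k) :
    ∃ P : ℂ[X], P.degree < (k + 1 : ℕ) ∧ ∀ z, f z = P.eval z := by
  refine ⟨∑ n : Fin (k + 1), C ((n.1.factorial : ℂ)⁻¹ * iteratedDeriv n f 0) * X ^ n.1,
    degree_sum_fin_lt _, fun z => ?_⟩
  have hsum := hasSum_sum_of_ne_finset_zero (s := Finset.range (k + 1)) (L := .unconditional ℕ)
    (f := fun n : ℕ => (n.factorial : ℂ)⁻¹ • (z - 0) ^ n • iteratedDeriv n f 0) fun n hn => by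
      rw [iteratedDeriv_eq_zero_of_norm_le hf hb (by simpa using hn), smul_zero, smul_zero]
  rw [(Complex.hasSum_taylorSeries_of_entire hf 0 z).unique hsum, eval_finsetSum,
    ← Fin.sum_univ_eq_sum_range]
  refine Finset.sum_congr rfl fun n _ => ?_
  simp only [sub_zero, smul_eq_mul, eval_mul, eval_C, eval_pow, eval_X]
  ring

theorem exists_polynomial_of_exists_tendsto (hf : DifferentiableOn ℂ f offReal)
    (hb : HasSlowGrowth f k 0) (hlim : ∀ z, ∃ y, Tendsto f (𝓝[offReal] z) (𝓝 y)) :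
    ∃ P : ℂ[X], P.degree < (k + 1 : ℕ) ∧ ∀ z ∈ offReal, f z = P.eval z := by
  obtain ⟨A, -, hA⟩ := hb
  set F := extendFrom offReal f
  have hFc : Continuous F := continuous_extendFrom dense_offReal hlim
  have hFf : Set.EqOn F f offReal := extendFrom_extends hf.continuousOn
  have hFb (z : ℂ) : ‖F z‖ ≤ A * (1 + ‖z‖) ^ k := by
    refine dense_offReal.induction (P := fun z => ‖F z‖ ≤ A * (1 + ‖z‖) ^ k) (fun w hw => ?_)
      (isClosed_le (by fun_prop) (by fun_prop)) z
    simpa [hFf hw] using hA w hw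
  obtain ⟨P, hP, hPF⟩ :=
    exists_polynomial_of_norm_le (differentiable_of_differentiableOn_offReal hFc (hf.congr hFf)) hFb
  exact ⟨P, hP, fun z hz => (hFf hz).symm.trans (hPF z)⟩

theorem exists_polynomial_smear (hf : DifferentiableOn ℂ f offReal) (hb : HasSlowGrowth f k m)
    (hj : HasWeakJump f 0) (hφ : IsTestFunction φ) :
    ∃ P : ℂ[X], P.degree < (k + 1 : ℕ) ∧ ∀ z ∈ offReal, smear φ f z = P.eval z := by
  have hderiv (z : ℂ) (hz : z ∈ offReal) := hasDerivAt_smear_deriv_left hf hφ hz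
  refine exists_polynomial_of_exists_tendsto
    (fun z hz => (hderiv z hz).differentiableAt.differentiableWithinAt)
    (hasSlowGrowth_smear_zero hf hb hφ)
    (exists_tendsto_nhdsWithin_offReal hderiv (hasSlowGrowth_smear_zero hf hb hφ.deriv) fun x => ?_)
  simpa using tendsto_smear_sub_smear hf.continuousOn hj hφ x

theorem exists_tendsto_smear (hf : ContinuousOn f offReal) :
    ∃ φ : ℕ → ℝ → ℂ, (∀ n, IsTestFunction (φ n)) ∧
      ∀ z ∈ offReal, Tendsto (fun n => smear (φ n) f z) atTop (𝓝 (f z)) := by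
  let bump (n : ℕ) : ContDiffBump (0 : ℝ) :=
    ⟨1 / (n + 1 : ℝ) / 2, 1 / (n + 1 : ℝ), by positivity, half_lt_self (by positivity)⟩
  refine ⟨fun n t => ((bump n).normed volume t : ℂ), fun n => ⟨?_, ?_⟩, fun z hz => ?_⟩
  · exact Complex.ofRealCLM.contDiff.comp (bump n).contDiff_normed
  · exact (bump n).hasCompactSupport_normed.comp_left (g := fun t : ℝ => (t : ℂ)) (by simp)
  · have hlim := ContDiffBump.convolution_tendsto_right_of_continuous (μ := (volume : Measure ℝ))
      (φ := bump) (g := fun t : ℝ => f (z + t)) tendsto_one_div_add_atTop_nhds_zero_nat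
      (hf.comp_continuous (by fun_prop) (by simpa [offReal] using hz)) 0
    simpa [smear, MeasureTheory.convolution, ← sub_eq_add_neg] using hlim

/-- Smearing turns `f` into polynomials of bounded degree, and interpolation at finitely many nodes
passes this to the limit. -/
theorem exists_polynomial_of_hasWeakJump_zero (hf : DifferentiableOn ℂ f offReal)
    (hb : HasSlowGrowth f k m) (hj : HasWeakJump f 0) :
    ∃ P : ℂ[X], ∀ z ∈ offReal, f z = P.eval z := by
  obtain ⟨φ, hφ, hlim⟩ := exists_tendsto_smear hf.continuousOn
  choose P hPd hP using fun n => exists_polynomial_smear hf hb hj (hφ n)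
  let node (j : ℕ) : ℂ := j + I
  have hnode : Set.InjOn node (Finset.range (k + 1)) := fun a _ b _ hab => by
    simpa [node] using hab
  have hnode' (j : ℕ) : node j ∈ offReal := by simp [node, offReal]
  have heval (r : ℕ → ℂ) (z : ℂ) :
      (Lagrange.interpolate (Finset.range (k + 1)) node r).eval z = ∑ j ∈ Finset.range (k + 1),
        r j * (Lagrange.basis (Finset.range (k + 1)) node j).eval z := by
    simp [Lagrange.interpolate_apply, eval_finsetSum]
  refine ⟨Lagrange.interpolate (Finset.range (k + 1)) node fun j => f (node j), fun z hz => ?_⟩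
  refine tendsto_nhds_unique (hlim z hz) ?_
  rw [heval]
  refine (tendsto_finsetSum _ fun j _ => (hlim _ (hnode' j)).mul_const _).congr fun n => ?_
  rw [hP n z hz, ← heval fun j => smear (φ n) f (node j)]
  congr 1
  exact (Lagrange.eq_interpolate_of_eval_eq _ hnode (by simpa using hPd n)
    fun j _ => (hP n _ (hnode' j)).symm).symm

end WeakJump

/-! ### Cauchy transforms -/

/-- The Cauchy transform `∫ ρ(t) dt / (z - t)` of a density on the line. -/
def cauchyTransform (ρ : ℝ → ℂ) (z : ℂ) : ℂ := ∫ t : ℝ, ρ t / (z - t)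

/-- The point `z` has positive distance from the set where `ρ` does not vanish. -/
def IsSeparated (ρ : ℝ → ℂ) (z : ℂ) : Prop := ∃ δ > 0, ∀ t : ℝ, ρ t ≠ 0 → δ ≤ ‖z - t‖

/-- All moments of `ρ` are finite. -/
def HasMoments (ρ : ℝ → ℂ) : Prop := ∀ n : ℕ, Integrable fun t : ℝ => (t : ℂ) ^ n * ρ t

section CauchyTransform

variable {ρ σ : ℝ → ℂ} {z : ℂ}

theorem abs_im_le_norm_sub_ofReal (z : ℂ) (t : ℝ) : |z.im| ≤ ‖z - t‖ := by
  simpa using Complex.abs_im_le_norm (z - t)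

theorem isSeparated_of_mem_offReal (ρ : ℝ → ℂ) (hz : z ∈ offReal) : IsSeparated ρ z :=
  ⟨|z.im|, abs_pos.2 hz, fun t _ => abs_im_le_norm_sub_ofReal z t⟩

theorem isSeparated_of_notMem {K : Set ℝ} (hK : IsClosed K) (hρ : ∀ t, ρ t ≠ 0 → t ∈ K)
    (hz : z ∉ (fun t : ℝ => (t : ℂ)) '' K) : IsSeparated ρ z := by
  have hcl : IsClosed ((fun t : ℝ => (t : ℂ)) '' K) :=
    Complex.isometry_ofReal.isClosedEmbedding.isClosedMap K hK
  obtain ⟨δ, hδ, hb⟩ := Metric.isOpen_iff.1 hcl.isOpen_compl z hz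
  refine ⟨δ, hδ, fun t ht => ?_⟩
  by_contra! hlt
  exact hb (mem_ball_iff_norm'.2 hlt) ⟨t, hρ t ht, rfl⟩

theorem IsSeparated.mul_left (h : IsSeparated ρ z) (g : ℝ → ℂ) :
    IsSeparated (fun t => g t * ρ t) z := by
  obtain ⟨δ, hδ, h⟩ := h
  exact ⟨δ, hδ, fun t ht => h t (right_ne_zero_of_mul ht)⟩

theorem IsSeparated.sub_ne_zero (h : IsSeparated ρ z) {t : ℝ} (ht : ρ t ≠ 0) : z - t ≠ 0 := by
  obtain ⟨δ, hδ, h⟩ := h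
  exact norm_pos_iff.1 (hδ.trans_le (h t ht))

theorem HasMoments.integrable (h : HasMoments ρ) : Integrable ρ := by
  simpa using h 0

theorem HasMoments.pow_mul (h : HasMoments ρ) (m : ℕ) :
    HasMoments fun t => (t : ℂ) ^ m * ρ t := fun n => by
  simpa only [← mul_assoc, ← pow_add] using h (n + m)

theorem HasMoments.add (hρ : HasMoments ρ) (hσ : HasMoments σ) :
    HasMoments fun t => ρ t + σ t := fun n => by
  simpa only [mul_add] using! (hρ n).add (hσ n)

theorem HasMoments.const_mul (hρ : HasMoments ρ) (a : ℂ) :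
    HasMoments fun t => a * ρ t := fun n => by
  simpa only [mul_left_comm] using (hρ n).const_mul a

theorem HasMoments.polynomial_mul (h : HasMoments ρ) (f : ℂ[X]) :
    HasMoments fun t : ℝ => f.eval (t : ℂ) * ρ t := by
  induction f using Polynomial.induction_on' with
  | add f g hf hg => simpa only [eval_add, add_mul] using hf.add hg
  | monomial n a => simpa only [eval_monomial, mul_assoc] using (h.pow_mul n).const_mul a

theorem aestronglyMeasurable_div_sub (hρ : Integrable ρ) (z : ℂ) :
    AEStronglyMeasurable (fun t : ℝ => ρ t / (z - t)) :=
  hρ.aestronglyMeasurable.mul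
    (by fun_prop : Measurable fun t : ℝ => (z - t)⁻¹).aestronglyMeasurable

theorem integrable_div_sub (hρ : Integrable ρ) (hz : IsSeparated ρ z) :
    Integrable fun t : ℝ => ρ t / (z - t) := by
  obtain ⟨δ, hδ, hz⟩ := hz
  refine (hρ.norm.mul_const δ⁻¹).mono' (aestronglyMeasurable_div_sub hρ z) (.of_forall fun t => ?_)
  by_cases ht : ρ t = 0
  · simp [ht]
  · rw [norm_div, div_eq_mul_inv]
    gcongr
    exact hz t ht

theorem norm_cauchyTransform_le (hρ : Integrable ρ) (hz : z ∈ offReal) :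
    ‖cauchyTransform ρ z‖ ≤ (∫ t, ‖ρ t‖) * |z.im|⁻¹ := by
  rw [← integral_mul_const]
  refine norm_integral_le_of_norm_le (hρ.norm.mul_const _) (.of_forall fun t => ?_)
  have : 0 < |z.im| := abs_pos.2 hz
  rw [norm_div, div_eq_mul_inv]
  gcongr
  exact abs_im_le_norm_sub_ofReal z t

theorem hasSlowGrowth_cauchyTransform (hρ : Integrable ρ) :
    HasSlowGrowth (cauchyTransform ρ) 0 1 := by
  refine ⟨∫ t, ‖ρ t‖, by positivity, fun z hz => (norm_cauchyTransform_le hρ hz).trans ?_⟩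
  rw [pow_zero, mul_one, pow_one]
  gcongr
  linarith

theorem differentiableAt_cauchyTransform (hρ : Integrable ρ) (hz : IsSeparated ρ z) :
    DifferentiableAt ℂ (cauchyTransform ρ) z := by
  have hint := integrable_div_sub hρ hz
  obtain ⟨δ, hδ, hz⟩ := hz
  have hball (w : ℂ) (hw : w ∈ Metric.ball z (δ / 2)) (t : ℝ) (ht : ρ t ≠ 0) :
      δ / 2 ≤ ‖w - t‖ := by
    have hzw : ‖z - t‖ ≤ ‖z - w‖ + ‖w - t‖ := by simpa using norm_add_le (z - w) (w - t)
    linarith [hz t ht, mem_ball_iff_norm'.1 hw]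
  refine (hasDerivAt_integral_of_dominated_loc_of_deriv_le (s := Metric.ball z (δ / 2))
    (F' := fun w t => ρ t * (-1 / (w - t) ^ 2)) (bound := fun t => ‖ρ t‖ * ((δ / 2) ^ 2)⁻¹)
    (Metric.ball_mem_nhds z (by positivity)) (.of_forall (aestronglyMeasurable_div_sub hρ)) hint
    (hρ.aestronglyMeasurable.mul
      (by fun_prop : Measurable fun t : ℝ => -1 / (z - t) ^ 2).aestronglyMeasurable)
    (.of_forall fun t w hw => ?_) (hρ.norm.mul_const _)
    (.of_forall fun t w hw => ?_)).2.differentiableAt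
  all_goals by_cases ht : ρ t = 0
  · simp [ht]
  · rw [norm_mul, norm_div, norm_neg, norm_one, one_div, norm_pow]
    gcongr
    exact hball w hw t ht
  · simpa [ht] using! hasDerivAt_const w (0 : ℂ)
  · have hne : w - t ≠ 0 := norm_pos_iff.1 ((half_pos hδ).trans_le (hball w hw t ht))
    simpa [div_eq_mul_inv] using! (((hasDerivAt_id w).sub_const (t : ℂ)).inv hne).const_mul (ρ t)

theorem differentiableOn_cauchyTransform (hρ : Integrable ρ) :
    DifferentiableOn ℂ (cauchyTransform ρ) offReal := fun _ hz =>
  (differentiableAt_cauchyTransform hρ (isSeparated_of_mem_offReal ρ hz)).differentiableWithinAt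

theorem mul_cauchyTransform (hρ : Integrable ρ) (hρ' : Integrable fun t : ℝ => (t : ℂ) * ρ t)
    (hz : IsSeparated ρ z) :
    z * cauchyTransform ρ z = (∫ t, ρ t) + cauchyTransform (fun t => (t : ℂ) * ρ t) z := by
  rw [cauchyTransform, cauchyTransform, ← integral_const_mul,
    ← integral_add hρ (integrable_div_sub hρ' (hz.mul_left _))]
  refine integral_congr_ae (.of_forall fun t => ?_)
  by_cases ht : ρ t = 0
  · simp [ht]
  · have := hz.sub_ne_zero ht
    field_simp
    ring

theorem cauchyTransform_add (hρ : Integrable ρ) (hσ : Integrable σ) (hz : IsSeparated ρ z)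
    (hz' : IsSeparated σ z) :
    cauchyTransform (fun t => ρ t + σ t) z = cauchyTransform ρ z + cauchyTransform σ z := by
  simp only [cauchyTransform, add_div]
  exact integral_add (integrable_div_sub hρ hz) (integrable_div_sub hσ hz')

theorem cauchyTransform_congr_ae (h : ρ =ᵐ[volume] σ) (z : ℂ) :
    cauchyTransform ρ z = cauchyTransform σ z :=
  integral_congr_ae (h.mono fun t ht => by simp only [ht])

theorem cauchyTransform_const_mul (ρ : ℝ → ℂ) (a z : ℂ) :
    cauchyTransform (fun t => a * ρ t) z = a * cauchyTransform ρ z := by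
  simp only [cauchyTransform, mul_div_assoc, integral_const_mul]

theorem cauchyTransform_sum {ι : Type*} (s : Finset ι) {ρ : ι → ℝ → ℂ}
    (hρ : ∀ i ∈ s, Integrable (ρ i)) (hz : ∀ i ∈ s, IsSeparated (ρ i) z) :
    cauchyTransform (fun t => ∑ i ∈ s, ρ i t) z = ∑ i ∈ s, cauchyTransform (ρ i) z := by
  simp only [cauchyTransform, Finset.sum_div]
  exact integral_finsetSum s fun i hi => integrable_div_sub (hρ i hi) (hz i hi)

theorem cauchyTransform_sub_mul (hρ : HasMoments ρ) (hz : IsSeparated ρ z) (w : ℂ) :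
    cauchyTransform (fun t => ((t : ℂ) - w) * ρ t) z =
      (z - w) * cauchyTransform ρ z - ∫ t, ρ t := by
  have hρ' : Integrable fun t : ℝ => (t : ℂ) * ρ t := by simpa using hρ 1
  have hmul := mul_cauchyTransform hρ.integrable hρ' hz
  simp only [sub_eq_add_neg (_ : ℂ) w, add_mul]
  rw [cauchyTransform_add hρ' (hρ.integrable.const_mul _) (hz.mul_left _) (hz.mul_left _),
    cauchyTransform_const_mul]
  linear_combination -hmul

theorem exists_polynomial_pow_mul_cauchyTransform (hρ : HasMoments ρ) (n : ℕ) :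
    ∃ D : ℂ[X], ∀ z, IsSeparated ρ z → z ^ n * cauchyTransform ρ z =
      D.eval z + cauchyTransform (fun t : ℝ => (t : ℂ) ^ n * ρ t) z := by
  induction n with
  | zero => exact ⟨0, fun z _ => by simp⟩
  | succ n ih =>
    obtain ⟨D, hD⟩ := ih
    refine ⟨X * D + C (∫ t : ℝ, (t : ℂ) ^ n * ρ t), fun z hz => ?_⟩
    have hmul := mul_cauchyTransform (hρ n)
      (by simpa only [← mul_assoc, ← pow_succ'] using hρ (n + 1)) (hz.mul_left _)
    simp only [← mul_assoc, ← pow_succ'] at hmul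
    rw [pow_succ', mul_assoc, hD z hz, mul_add, hmul]
    simp only [eval_add, eval_mul, eval_X, eval_C]
    ring

theorem exists_polynomial_mul_cauchyTransform (hρ : HasMoments ρ) (f : ℂ[X]) :
    ∃ D : ℂ[X], ∀ z, IsSeparated ρ z → f.eval z * cauchyTransform ρ z =
      D.eval z + cauchyTransform (fun t : ℝ => f.eval (t : ℂ) * ρ t) z := by
  induction f using Polynomial.induction_on' with
  | add f g hf hg =>
    obtain ⟨D, hD⟩ := hf
    obtain ⟨E, hE⟩ := hg
    refine ⟨D + E, fun z hz => ?_⟩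
    simp only [eval_add, add_mul]
    rw [hD z hz, hE z hz, cauchyTransform_add (hρ.polynomial_mul f).integrable
      (hρ.polynomial_mul g).integrable (hz.mul_left _) (hz.mul_left _)]
    ring
  | monomial n a =>
    obtain ⟨D, hD⟩ := exists_polynomial_pow_mul_cauchyTransform hρ n
    refine ⟨C a * D, fun z hz => ?_⟩
    simp only [eval_monomial, eval_mul, eval_C, mul_assoc, cauchyTransform_const_mul, hD z hz]
    ring

end CauchyTransform

/-! ### The jump of a Cauchy transform -/

/-- `π` times the Poisson extension of `φ` to the upper half-plane, at the point `t + i ε`. -/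
def poissonIntegral (φ : ℝ → ℂ) (ε t : ℝ) : ℂ :=
  ∫ s : ℝ, φ (t + ε * s) * ((1 + s ^ 2)⁻¹ : ℝ)

section PoissonIntegral

variable {φ ρ : ℝ → ℂ} {M ε : ℝ}

theorem continuous_inv_one_add_sq : Continuous fun s : ℝ => (1 + s ^ 2)⁻¹ :=
  Continuous.inv₀ (by fun_prop) fun s => by positivity

theorem continuous_poissonIntegrand (hφ : Continuous φ) (ε t : ℝ) :
    Continuous fun s : ℝ => φ (t + ε * s) * ((1 + s ^ 2)⁻¹ : ℝ) :=
  (hφ.comp (by fun_prop)).mul (Complex.continuous_ofReal.comp continuous_inv_one_add_sq)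

theorem norm_poissonIntegrand_le (hM : ∀ t, ‖φ t‖ ≤ M) (ε t s : ℝ) :
    ‖φ (t + ε * s) * ((1 + s ^ 2)⁻¹ : ℝ)‖ ≤ M * (1 + s ^ 2)⁻¹ := by
  rw [norm_mul, Complex.norm_real, Real.norm_of_nonneg (by positivity)]
  gcongr
  exact hM _

theorem norm_poissonIntegral_le (hM : ∀ t, ‖φ t‖ ≤ M) (ε t : ℝ) :
    ‖poissonIntegral φ ε t‖ ≤ M * Real.pi := by
  rw [← integral_univ_inv_one_add_sq, ← integral_const_mul]
  exact norm_integral_le_of_norm_le (integrable_inv_one_add_sq.const_mul M)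
    (.of_forall (norm_poissonIntegrand_le hM ε t))

theorem continuous_poissonIntegral (hφ : Continuous φ) (hM : ∀ t, ‖φ t‖ ≤ M) (ε : ℝ) :
    Continuous (poissonIntegral φ ε) :=
  continuous_of_dominated (fun t => (continuous_poissonIntegrand hφ ε t).aestronglyMeasurable)
    (fun t => .of_forall (norm_poissonIntegrand_le hM ε t))
    (integrable_inv_one_add_sq.const_mul M)
    (.of_forall fun s => (hφ.comp (by fun_prop)).mul continuous_const)

theorem tendsto_poissonIntegral (hφ : Continuous φ) (hM : ∀ t, ‖φ t‖ ≤ M) (t : ℝ) :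
    Tendsto (fun ε => poissonIntegral φ ε t) (𝓝 0) (𝓝 (φ t * Real.pi)) := by
  rw [← integral_univ_inv_one_add_sq, ← integral_complex_ofReal, ← integral_const_mul]
  refine tendsto_integral_filter_of_dominated_convergence (fun s => M * (1 + s ^ 2)⁻¹)
    (.of_forall fun ε => (continuous_poissonIntegrand hφ ε t).aestronglyMeasurable)
    (.of_forall fun ε => .of_forall (norm_poissonIntegrand_le hM ε t))
    (integrable_inv_one_add_sq.const_mul M) (.of_forall fun s => Tendsto.mul_const _ ?_)
  exact Continuous.tendsto' (by fun_prop) _ _ (by simp)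

theorem integral_mul_poissonKernel (φ : ℝ → ℂ) (hε : 0 < ε) (t : ℝ) :
    ∫ x, φ x * (ε / ((x - t) ^ 2 + ε ^ 2) : ℝ) = poissonIntegral φ ε t := by
  set F : ℝ → ℂ := fun x => φ x * (ε / ((x - t) ^ 2 + ε ^ 2) : ℝ) with hF
  have hscale := Measure.integral_comp_mul_left (fun u => F (t + u)) ε
  rw [integral_add_left_eq_self F t, abs_of_pos (inv_pos.2 hε)] at hscale
  calc ∫ x, F x = ε • ∫ s : ℝ, F (t + ε * s) := by
        rw [hscale, smul_smul, mul_inv_cancel₀ hε.ne', one_smul]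
    _ = ∫ s : ℝ, ε • F (t + ε * s) := (integral_smul _ _).symm
    _ = poissonIntegral φ ε t := by
        refine integral_congr_ae (.of_forall fun s => ?_)
        have hker : ε * (ε / ((ε * s) ^ 2 + ε ^ 2)) = (1 + s ^ 2)⁻¹ := by
          field_simp
          ring
        simp only [hF, add_sub_cancel_left, Complex.real_smul, ← hker]
        push_cast
        ring

theorem cauchyTransform_sub_cauchyTransform (hρ : Integrable ρ) (hε : 0 < ε) (x : ℝ) :
    cauchyTransform ρ (x + ε * I) - cauchyTransform ρ (x - ε * I) =
      ∫ t, ρ t * (-2 * I * (ε / ((x - t) ^ 2 + ε ^ 2) : ℝ)) := by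
  have hp := ofReal_add_mul_I_mem_offReal x hε.ne'
  have hn := ofReal_sub_mul_I_mem_offReal x hε.ne'
  rw [cauchyTransform, cauchyTransform,
    ← integral_sub (integrable_div_sub hρ (isSeparated_of_mem_offReal ρ hp))
      (integrable_div_sub hρ (isSeparated_of_mem_offReal ρ hn))]
  refine integral_congr_ae (.of_forall fun t => ?_)
  have hp' := (isSeparated_of_mem_offReal 1 hp).sub_ne_zero (t := t) one_ne_zero
  have hn' := (isSeparated_of_mem_offReal 1 hn).sub_ne_zero (t := t) one_ne_zero
  have hsq : ((x : ℂ) - t) ^ 2 + (ε : ℂ) ^ 2 ≠ 0 := by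
    exact_mod_cast (show 0 < (x - t) ^ 2 + ε ^ 2 by positivity).ne'
  push_cast
  field_simp
  linear_combination -(2 * ρ t * ε ^ 3 * I) * Complex.I_sq

theorem integrable_mul_mul_poissonKernel (hφ : Integrable φ) (hρ : Integrable ρ) (hε : 0 < ε) :
    Integrable (fun P : ℝ × ℝ =>
      φ P.1 * (ρ P.2 * (-2 * I * (ε / ((P.1 - P.2) ^ 2 + ε ^ 2) : ℝ)))) (volume.prod volume) := by
  have hpos (x t : ℝ) : 0 < (x - t) ^ 2 + ε ^ 2 := by positivity
  have hcont : Continuous fun P : ℝ × ℝ => -2 * I * (ε / ((P.1 - P.2) ^ 2 + ε ^ 2) : ℝ) :=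
    continuous_const.mul (Complex.continuous_ofReal.comp
      (Continuous.div (by fun_prop) (by fun_prop) fun P => (hpos _ _).ne'))
  have hbound (x t : ℝ) : ‖-2 * I * (ε / ((x - t) ^ 2 + ε ^ 2) : ℝ)‖ ≤ 2 * ε⁻¹ := by
    have hle : ε / ((x - t) ^ 2 + ε ^ 2) ≤ ε⁻¹ := by
      rw [div_le_iff₀ (hpos x t), inv_mul_eq_div, le_div_iff₀ hε]
      nlinarith [sq_nonneg (x - t)]
    rw [norm_mul, Complex.norm_real, Real.norm_of_nonneg (div_nonneg hε.le (hpos x t).le)]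
    simpa using hle
  have hprod : Integrable (fun P : ℝ × ℝ => φ P.1 * ρ P.2) (volume.prod volume) := hφ.mul_prod hρ
  simpa only [mul_assoc] using hprod.mul_bdd (c := 2 * ε⁻¹) hcont.aestronglyMeasurable
    (.of_forall fun P => hbound P.1 P.2)

theorem integral_mul_cauchyTransform_sub (hφ : Integrable φ) (hρ : Integrable ρ) (hε : 0 < ε) :
    ∫ x : ℝ, φ x * (cauchyTransform ρ (x + ε * I) - cauchyTransform ρ (x - ε * I)) =
      -2 * I * ∫ t, ρ t * poissonIntegral φ ε t := by
  have hswap := integral_integral_swap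
    (f := fun x t => φ x * (ρ t * (-2 * I * (ε / ((x - t) ^ 2 + ε ^ 2) : ℝ))))
    (integrable_mul_mul_poissonKernel hφ hρ hε)
  simp only [integral_const_mul, ← cauchyTransform_sub_cauchyTransform hρ hε] at hswap
  rw [hswap, ← integral_const_mul]
  congr with t
  rw [← integral_mul_poissonKernel φ hε t, ← mul_assoc, ← integral_const_mul]
  congr with x
  ring

theorem hasWeakJump_cauchyTransform (hρ : Integrable ρ) :
    HasWeakJump (cauchyTransform ρ) fun x => -2 * Real.pi * I * ρ x := by
  intro φ hφ
  obtain ⟨M, hM⟩ := hφ.hasCompactSupport.exists_bound_of_continuous hφ.continuous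
  have hlim : Tendsto (fun ε => ∫ t, ρ t * poissonIntegral φ ε t) (𝓝[>] 0)
      (𝓝 (∫ t, ρ t * (φ t * Real.pi))) := by
    refine tendsto_integral_filter_of_dominated_convergence (fun t => ‖ρ t‖ * (M * Real.pi))
      (.of_forall fun ε => hρ.aestronglyMeasurable.mul
        (continuous_poissonIntegral hφ.continuous hM ε).aestronglyMeasurable)
      (.of_forall fun ε => .of_forall fun t => ?_) (hρ.norm.mul_const _)
      (.of_forall fun t => ((tendsto_poissonIntegral hφ.continuous hM t).mono_left
        nhdsWithin_le_nhds).const_mul _)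
    rw [norm_mul]
    gcongr
    exact norm_poissonIntegral_le hM ε t
  have hval : -2 * I * ∫ t, ρ t * (φ t * Real.pi) = ∫ x, φ x * (-2 * Real.pi * I * ρ x) := by
    rw [← integral_const_mul]
    congr with t
    ring
  rw [← hval]
  refine (hlim.const_mul (-2 * I)).congr' ?_
  filter_upwards [self_mem_nhdsWithin] with ε hε
  exact (integral_mul_cauchyTransform_sub
    (hφ.continuous.integrable_of_hasCompactSupport hφ.hasCompactSupport) hρ hε).symm

end PoissonIntegral

/-! ### Behaviour along the imaginary axis -/

/-- The point `i s` going to infinity with `s → +∞`. -/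
def imaginaryRay : Filter ℂ := map (fun s : ℝ => s * I) atTop

instance : imaginaryRay.NeBot := map_neBot

theorem imaginaryRay_le_cobounded : imaginaryRay ≤ Bornology.cobounded ℂ :=
  tendsto_norm_atTop_iff_cobounded.1 (by simpa using! tendsto_abs_atTop_atTop)

theorem eventually_imaginaryRay_mem_offReal : ∀ᶠ z in imaginaryRay, z ∈ offReal := by
  rw [imaginaryRay, eventually_map]
  filter_upwards [eventually_gt_atTop 0] with s hs
  simpa [offReal] using hs.ne'

theorem tendsto_cauchyTransform_imaginaryRay {ρ : ℝ → ℂ} (hρ : Integrable ρ) :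
    Tendsto (cauchyTransform ρ) imaginaryRay (𝓝 0) := by
  have him : Tendsto (fun z : ℂ => (∫ t, ‖ρ t‖) * |z.im|⁻¹) imaginaryRay (𝓝 0) := by
    have : Tendsto (fun s : ℝ => |s|⁻¹) atTop (𝓝 0) := tendsto_abs_atTop_atTop.inv_tendsto_atTop
    simpa [imaginaryRay, Function.comp_def] using this.const_mul (∫ t, ‖ρ t‖)
  exact squeeze_zero_norm' (eventually_imaginaryRay_mem_offReal.mono fun z hz =>
    norm_cauchyTransform_le hρ hz) him

section Polynomial

variable {𝕜 : Type*} [NormedField 𝕜] {l : Filter 𝕜} {P : 𝕜[X]} {L : 𝕜} {n : ℕ}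

theorem eventually_ne_zero_of_le_cobounded (hl : l ≤ Bornology.cobounded 𝕜) :
    ∀ᶠ z in l, z ≠ 0 :=
  hl (Bornology.eventually_ne_cobounded 0)

theorem eq_C_of_tendsto_eval [l.NeBot] (hl : l ≤ Bornology.cobounded 𝕜)
    (h : Tendsto P.eval l (𝓝 L)) : P = C L := by
  rcases lt_or_ge 0 P.degree with hd | hd
  · exact absurd h.norm (not_tendsto_nhds_of_tendsto_atTop
      (P.tendsto_norm_atTop hd (tendsto_norm_atTop_iff_cobounded.2 hl)) _)
  · rw [eq_C_of_degree_le_zero hd] at h ⊢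
    simp only [eval_C] at h
    rw [tendsto_nhds_unique tendsto_const_nhds h]

theorem tendsto_eval_div_pow_of_degree_lt (hl : l ≤ Bornology.cobounded 𝕜) (h : P.degree < n) :
    Tendsto (fun z => P.eval z / z ^ n) l (𝓝 0) := by
  have hlt {i : ℕ} (hi : i ∈ P.support) : i < n := by
    exact_mod_cast (le_degree_of_mem_supp i hi).trans_lt h
  have hterm (i : ℕ) (hi : i ∈ P.support) :
      Tendsto (fun z => P.coeff i * z⁻¹ ^ (n - i)) l (𝓝 0) := by
    have hpow := ((tendsto_inv₀_cobounded (α := 𝕜)).mono_left hl).pow (n - i)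
    rw [zero_pow (Nat.sub_pos_of_lt (hlt hi)).ne'] at hpow
    simpa using hpow.const_mul (P.coeff i)
  rw [← Finset.sum_const_zero (s := P.support)]
  refine (tendsto_finsetSum _ hterm).congr' ?_
  filter_upwards [eventually_ne_zero_of_le_cobounded hl] with z hz
  rw [eval_eq_sum, sum_def, Finset.sum_div]
  refine Finset.sum_congr rfl fun i hi => ?_
  rw [← Nat.add_sub_of_le (hlt hi).le, pow_add, Nat.add_sub_cancel_left, inv_pow]
  field_simp

theorem degree_le_of_tendsto_eval_div_pow [l.NeBot] (hl : l ≤ Bornology.cobounded 𝕜)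
    (h : Tendsto (fun z => P.eval z / z ^ n) l (𝓝 L)) : P.degree ≤ n := by
  have hmonic : (X ^ n : 𝕜[X]).Monic := monic_X_pow n
  have hrem : (P %ₘ X ^ n).degree < n := by simpa using degree_modByMonic_lt P hmonic
  have hquot : Tendsto (P /ₘ X ^ n).eval l (𝓝 (L - 0)) := by
    refine (h.sub (tendsto_eval_div_pow_of_degree_lt hl hrem)).congr' ?_
    filter_upwards [eventually_ne_zero_of_le_cobounded hl] with z hz
    have hz := congrArg (eval z) (modByMonic_add_div P (X ^ n))
    simp only [eval_add, eval_mul, eval_pow, eval_X] at hz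
    rw [← hz]
    field_simp
    ring
  rw [← modByMonic_add_div P (X ^ n), eq_C_of_tendsto_eval hl hquot, mul_comm]
  exact degree_add_le_of_degree_le hrem.le (degree_C_mul_X_pow_le n _)

end Polynomial

theorem eq_C_of_tendsto_add_cauchyTransform {ρ : ℝ → ℂ} {Q : ℂ[X]} {L : ℂ} (hρ : Integrable ρ)
    (hL : Tendsto (fun z => Q.eval z + cauchyTransform ρ z) imaginaryRay (𝓝 L)) : Q = C L := by
  refine eq_C_of_tendsto_eval imaginaryRay_le_cobounded ?_
  simpa only [add_sub_cancel_right, sub_zero] using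
    hL.sub (tendsto_cauchyTransform_imaginaryRay hρ)

/-! ### Reconstruction of a function from its jump -/

theorem HasSlowGrowth.mono {f : ℂ → ℂ} {k k' m m' : ℕ} (hf : HasSlowGrowth f k m) (hk : k ≤ k')
    (hm : m ≤ m') : HasSlowGrowth f k' m' := by
  obtain ⟨A, hA, hf⟩ := hf
  refine ⟨A, hA, fun z hz => (hf z hz).trans ?_⟩
  gcongr <;> simp

theorem HasSlowGrowth.sub {f g : ℂ → ℂ} {k m : ℕ} (hf : HasSlowGrowth f k m)
    (hg : HasSlowGrowth g k m) : HasSlowGrowth (fun z => f z - g z) k m := by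
  obtain ⟨A, hA, hf⟩ := hf
  obtain ⟨B, hB, hg⟩ := hg
  refine ⟨A + B, by positivity, fun z hz => (norm_sub_le _ _).trans ?_⟩
  linarith [hf z hz, hg z hz]

theorem integrable_mul_jump {f : ℂ → ℂ} (hf : ContinuousOn f offReal) {φ : ℝ → ℂ}
    (hφ : IsTestFunction φ) {ε : ℝ} (hε : ε ≠ 0) :
    Integrable fun x : ℝ => φ x * (f (x + ε * I) - f (x - ε * I)) :=
  (hφ.continuous.mul (Continuous.sub
    (hf.comp_continuous (by fun_prop) fun x => ofReal_add_mul_I_mem_offReal x hε)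
    (hf.comp_continuous (by fun_prop) fun x => ofReal_sub_mul_I_mem_offReal x hε)
    )).integrable_of_hasCompactSupport hφ.hasCompactSupport.mul_right

theorem HasWeakJump.sub_self {f g : ℂ → ℂ} {ρ : ℝ → ℂ} (hf : ContinuousOn f offReal)
    (hg : ContinuousOn g offReal) (hfρ : HasWeakJump f ρ) (hgρ : HasWeakJump g ρ) :
    HasWeakJump (fun z => f z - g z) 0 := by
  intro φ hφ
  have hlim := (hfρ φ hφ).sub (hgρ φ hφ)
  simp only [_root_.sub_self] at hlim
  simp only [Pi.zero_apply, mul_zero, integral_zero]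
  refine hlim.congr' ?_
  filter_upwards [self_mem_nhdsWithin] with ε hε
  have hε0 : ε ≠ 0 := ne_of_gt hε
  rw [← integral_sub (integrable_mul_jump hf hφ hε0) (integrable_mul_jump hg hφ hε0)]
  congr with x
  ring

theorem exists_polynomial_add_cauchyTransform {f : ℂ → ℂ} {k m : ℕ} {ρ : ℝ → ℂ}
    (hf : DifferentiableOn ℂ f offReal) (hb : HasSlowGrowth f k m) (hρ : Integrable ρ)
    (hj : HasWeakJump f fun x => -2 * Real.pi * I * ρ x) :
    ∃ P : ℂ[X], ∀ z ∈ offReal, f z = P.eval z + cauchyTransform ρ z := by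
  have hdiff := differentiableOn_cauchyTransform hρ
  obtain ⟨P, hP⟩ := exists_polynomial_of_hasWeakJump_zero (hf.sub hdiff)
    ((hb.mono le_rfl (Nat.le_add_right m 1)).sub
      ((hasSlowGrowth_cauchyTransform hρ).mono k.zero_le (Nat.le_add_left 1 m)))
    (hj.sub_self hf.continuousOn hdiff.continuousOn (hasWeakJump_cauchyTransform hρ))
  exact ⟨P, fun z hz => sub_eq_iff_eq_add.1 (hP z hz)⟩

/-- The weak form of the jump relation `f₊ = f₋ - 2πi r g₋`, coupling two entries in one row of a
Riemann-Hilbert problem with triangular jump matrix. -/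
def HasTriangularJump (f g : ℂ → ℂ) (r : ℝ → ℂ) : Prop :=
  ∀ φ : ℝ → ℂ, IsTestFunction φ →
    Tendsto (fun ε : ℝ => ∫ x : ℝ, φ x *
      (f (x + ε * I) - (g (x - ε * I) * (-2 * Real.pi * I * r x) + f (x - ε * I)))) (𝓝[>] 0) (𝓝 0)

/-- With respect to the weight `r`, the function `g` has the boundary values `g₀` from below,
attained almost everywhere and with local domination. -/
structure HasDominatedBoundaryValues (g : ℂ → ℂ) (r g₀ : ℝ → ℂ) : Prop where
  dominated : ∀ K : Set ℝ, IsCompact K → ∃ B : ℝ → ℝ, Integrable B ∧ ∀ᵐ x : ℝ, x ∈ K →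
    ∀ ε ∈ Set.Ioo (0 : ℝ) 1, ‖g (x - ε * I) * r x‖ ≤ B x
  tendsto : ∀ᵐ x : ℝ, Tendsto (fun ε : ℝ => g (x - ε * I) * r x) (𝓝[>] 0) (𝓝 (g₀ x * r x))

section TriangularJump

variable {f g : ℂ → ℂ} {r g₀ φ : ℝ → ℂ}

theorem HasDominatedBoundaryValues.exists_bound (h : HasDominatedBoundaryValues g r g₀)
    (hφ : IsTestFunction φ) : ∃ B : ℝ → ℝ, Integrable B ∧ ∀ ε ∈ Set.Ioo (0 : ℝ) 1, ∀ᵐ x : ℝ,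
      ‖φ x * (g (x - ε * I) * r x)‖ ≤ B x := by
  obtain ⟨B, hB, hgB⟩ := h.dominated _ hφ.hasCompactSupport
  obtain ⟨M, hM⟩ := hφ.hasCompactSupport.exists_bound_of_continuous hφ.continuous
  refine ⟨fun x => ‖φ x‖ * B x, hB.bdd_mul hφ.continuous.norm.aestronglyMeasurable
    (.of_forall fun x => by simpa using hM x), fun ε hε => ?_⟩
  filter_upwards [hgB] with x hx
  rw [norm_mul]
  by_cases hxφ : x ∈ tsupport φ
  · gcongr
    exact hx hxφ ε hε
  · simp [image_eq_zero_of_notMem_tsupport hxφ]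

theorem aestronglyMeasurable_mul_boundary (hg : ContinuousOn g offReal)
    (hr : AEStronglyMeasurable r) (hφ : IsTestFunction φ) {ε : ℝ} (hε : ε ≠ 0) :
    AEStronglyMeasurable fun x : ℝ => φ x * (g (x - ε * I) * r x) :=
  hφ.continuous.aestronglyMeasurable.mul (AEStronglyMeasurable.mul (hg.comp_continuous
    (by fun_prop) fun x => ofReal_sub_mul_I_mem_offReal x hε).aestronglyMeasurable hr)

theorem HasTriangularJump.hasWeakJump (h : HasTriangularJump f g r)
    (hf : ContinuousOn f offReal) (hg : ContinuousOn g offReal) (hr : AEStronglyMeasurable r)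
    (hb : HasDominatedBoundaryValues g r g₀) :
    HasWeakJump f fun x => -2 * Real.pi * I * (g₀ x * r x) := by
  intro φ hφ
  obtain ⟨B, hB, hbound⟩ := hb.exists_bound hφ
  have hmeas (ε : ℝ) (hε : ε ∈ Set.Ioo (0 : ℝ) 1) :=
    aestronglyMeasurable_mul_boundary hg hr hφ hε.1.ne'
  have hsmall : ∀ᶠ ε : ℝ in 𝓝[>] 0, ε ∈ Set.Ioo (0 : ℝ) 1 := Ioo_mem_nhdsGT one_pos
  have hboundary : Tendsto (fun ε : ℝ => ∫ x : ℝ, φ x * (g (x - ε * I) * r x)) (𝓝[>] 0)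
      (𝓝 (∫ x, φ x * (g₀ x * r x))) :=
    tendsto_integral_filter_of_dominated_convergence B (hsmall.mono hmeas) (hsmall.mono hbound) hB
      (hb.tendsto.mono fun x hx => hx.const_mul _)
  have hlim := (h φ hφ).add (hboundary.const_mul (-2 * Real.pi * I))
  rw [zero_add, ← integral_const_mul] at hlim
  simp only [mul_left_comm (φ _) (-2 * Real.pi * I)]
  refine hlim.congr' (hsmall.mono fun ε hε => ?_)
  have hgr := (hB.mono' (hmeas ε hε) (hbound ε hε)).const_mul (-2 * Real.pi * I)
  have hsplit (x : ℝ) :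
      φ x * (f (x + ε * I) - (g (x - ε * I) * (-2 * Real.pi * I * r x) + f (x - ε * I))) =
        φ x * (f (x + ε * I) - f (x - ε * I)) -
          -2 * Real.pi * I * (φ x * (g (x - ε * I) * r x)) := by ring
  simp only [hsplit]
  rw [integral_sub (integrable_mul_jump hf hφ hε.1.ne') hgr, integral_const_mul, sub_add_cancel]

end TriangularJump

/-! ### Biorthogonal systems for the Cauchy kernel -/

/-- The Cauchy transform of `f ρ`, i.e. the function of the second kind that belongs to the
polynomial `f` and the weight `ρ`. -/
def secondKind (ρ : ℝ → ℂ) (f : ℂ[X]) (z : ℂ) : ℂ :=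
  cauchyTransform (fun t => f.eval (t : ℂ) * ρ t) z

section SecondKind

variable {ρ : ℝ → ℂ} {z : ℂ}

theorem continuousAt_secondKind (hρ : HasMoments ρ) (f : ℂ[X]) (hz : IsSeparated ρ z) :
    ContinuousAt (secondKind ρ f) z :=
  (differentiableAt_cauchyTransform (hρ.polynomial_mul f).integrable (hz.mul_left _)).continuousAt

theorem secondKind_sum {ι : Type*} (hρ : HasMoments ρ) (hz : IsSeparated ρ z) (s : Finset ι)
    (c : ι → ℂ) (f : ι → ℂ[X]) :
    secondKind ρ (∑ i ∈ s, C (c i) * f i) z = ∑ i ∈ s, c i * secondKind ρ (f i) z := by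
  simp only [secondKind, eval_finsetSum, eval_mul, eval_C, Finset.sum_mul, mul_assoc,
    ← cauchyTransform_const_mul]
  exact cauchyTransform_sum s
    (fun i _ => (hρ.polynomial_mul (f i)).integrable.const_mul (c i))
    fun i _ => (hz.mul_left _).mul_left _

theorem secondKind_X_sub_C_mul (hρ : HasMoments ρ) (hz : IsSeparated ρ z) (w : ℂ) (f : ℂ[X]) :
    secondKind ρ ((X - C w) * f) z =
      (z - w) * secondKind ρ f z - ∫ t : ℝ, f.eval (t : ℂ) * ρ t := by
  simp only [secondKind, ← cauchyTransform_sub_mul (hρ.polynomial_mul f) (hz.mul_left _), eval_mul,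
    eval_sub, eval_X, eval_C, mul_assoc]

end SecondKind

/-- A pair of complex densities, one on the positive and one on the negative half-line, with finite
moments and finite bimoments for the Cauchy kernel `1 / (y - x)`. This is the setting of a Nikishin
system generated by two measures on disjoint intervals. -/
structure IsNikishinPair (a b : ℝ → ℂ) : Prop where
  supp_left : ∀ t < 0, a t = 0
  supp_right : ∀ t > 0, b t = 0
  moments_left : HasMoments a
  moments_right : HasMoments b
  bimoments : ∀ i j : ℕ, Integrable (fun P : ℝ × ℝ =>
    (P.1 : ℂ) ^ i * a P.1 / ((P.2 : ℂ) - P.1) * ((P.2 : ℂ) ^ j * b P.2)) (volume.prod volume)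

/-- The bilinear form `∬ f(x) g(y) a(x) b(y) dx dy / (x - y)`. -/
def cauchyPairing (a b : ℝ → ℂ) (f g : ℂ[X]) : ℂ :=
  -∫ t : ℝ, secondKind a f t * (g.eval (t : ℂ) * b t)

/-- Two sequences of polynomials that are biorthonormal for the Cauchy kernel, with one polynomial
of each degree. -/
structure IsBiorthonormal (a b : ℝ → ℂ) (A B : ℕ → ℂ[X]) : Prop where
  degree_left : ∀ j, (A j).degree = j
  degree_right : ∀ j, (B j).degree = j
  pairing : ∀ j k, cauchyPairing a b (A j) (B k) = if j = k then 1 else 0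

section NikishinPair

variable {a b : ℝ → ℂ}

theorem IsNikishinPair.integrable_kernel (h : IsNikishinPair a b) (f g : ℂ[X]) :
    Integrable (fun P : ℝ × ℝ => f.eval (P.1 : ℂ) * a P.1 / ((P.2 : ℂ) - P.1) *
      (g.eval (P.2 : ℂ) * b P.2)) (volume.prod volume) := by
  have hsum : (fun P : ℝ × ℝ => f.eval (P.1 : ℂ) * a P.1 / ((P.2 : ℂ) - P.1) *
      (g.eval (P.2 : ℂ) * b P.2)) = fun P => ∑ i ∈ f.support, ∑ j ∈ g.support,
        f.coeff i * g.coeff j * ((P.1 : ℂ) ^ i * a P.1 / ((P.2 : ℂ) - P.1) *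
          ((P.2 : ℂ) ^ j * b P.2)) := by
    funext P
    simp only [eval_eq_sum, Polynomial.sum, Finset.sum_mul, Finset.mul_sum, Finset.sum_div]
    rw [Finset.sum_comm]
    exact Finset.sum_congr rfl fun i _ => Finset.sum_congr rfl fun j _ => by ring
  rw [hsum]
  exact integrable_finsetSum _ fun i _ => integrable_finsetSum _ fun j _ =>
    (h.bimoments i j).const_mul _

theorem isSeparated_of_neg {ρ : ℝ → ℂ} (hρ : ∀ s < 0, ρ s = 0) {t : ℝ} (ht : t < 0) :
    IsSeparated ρ t := by
  refine ⟨-t, neg_pos.2 ht, fun s hs => ?_⟩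
  have hs0 : 0 ≤ s := le_of_not_gt fun hs0 => hs (hρ s hs0)
  rw [← Complex.ofReal_sub, Complex.norm_real, Real.norm_eq_abs, abs_of_nonpos (by linarith)]
  linarith

theorem IsNikishinPair.ae_neg_or_eq_zero (h : IsNikishinPair a b) : ∀ᵐ t : ℝ, t < 0 ∨ b t = 0 := by
  filter_upwards [Measure.ae_ne volume (0 : ℝ)] with t ht
  exact ht.lt_or_gt.imp_right (h.supp_right t)

theorem IsNikishinPair.mul_ae_eq (h : IsNikishinPair a b) {f g : ℝ → ℂ}
    (hfg : ∀ t : ℝ, IsSeparated a t → f t = g t) :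
    (fun t => f t * b t) =ᵐ[volume] fun t => g t * b t := by
  filter_upwards [h.ae_neg_or_eq_zero] with t ht
  rcases ht with ht | ht
  · rw [hfg t (isSeparated_of_neg h.supp_left ht)]
  · rw [ht, mul_zero, mul_zero]

theorem IsNikishinPair.integrable_secondKind_mul (h : IsNikishinPair a b) (f g : ℂ[X]) :
    Integrable fun t : ℝ => secondKind a f t * (g.eval (t : ℂ) * b t) := by
  simpa only [integral_mul_const] using! (h.integrable_kernel f g).integral_prod_right

theorem IsNikishinPair.cauchyPairing_sum {ι : Type*} (h : IsNikishinPair a b) (s : Finset ι)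
    (c : ι → ℂ) (f : ι → ℂ[X]) (g : ℂ[X]) :
    cauchyPairing a b (∑ i ∈ s, C (c i) * f i) g = ∑ i ∈ s, c i * cauchyPairing a b (f i) g := by
  have hsum : (fun t : ℝ => secondKind a (∑ i ∈ s, C (c i) * f i) t * g.eval (t : ℂ) * b t)
      =ᵐ[volume] fun t => (∑ i ∈ s, c i * (secondKind a (f i) t * g.eval (t : ℂ))) * b t := by
    refine h.mul_ae_eq fun t ht => ?_
    simp only [secondKind_sum h.moments_left ht, Finset.sum_mul, mul_assoc]
  simp only [← mul_assoc] at hsum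
  simp only [cauchyPairing, mul_neg, Finset.sum_neg_distrib, ← integral_const_mul, neg_inj]
  rw [← integral_finsetSum s fun i _ => (h.integrable_secondKind_mul (f i) g).const_mul (c i)]
  simp only [← mul_assoc]
  rw [integral_congr_ae hsum]
  simp only [Finset.sum_mul]

theorem exists_eq_sum_of_degree_eq {A : ℕ → ℂ[X]} (hA : ∀ j, (A j).degree = j) {n : ℕ} {f : ℂ[X]}
    (hf : f.degree < n) : ∃ c : ℕ → ℂ, f = ∑ j ∈ Finset.range n, C (c j) * A j := by
  let S : Polynomial.Sequence ℂ := ⟨A, hA⟩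
  have hspan := S.span_degreeLT (m := n) fun i _ =>
    (leadingCoeff_ne_zero.2 (S.ne_zero i)).isUnit
  rw [← mem_degreeLT, ← hspan, ← Finset.coe_range,
    Submodule.mem_span_image_finset_iff_exists_fun'] at hf
  obtain ⟨c, hc⟩ := hf
  exact ⟨c, by simp only [← hc, smul_eq_C_mul]; rfl⟩

theorem IsBiorthonormal.eq_sum_of_reproducing {A B : ℕ → ℂ[X]} (hAB : IsBiorthonormal a b A B)
    (h : IsNikishinPair a b) {K : ℂ[X]} {N : ℕ} (hK : K.degree < N) {w : ℂ}
    (hKw : ∀ k < N, cauchyPairing a b K (B k) = (B k).eval w) :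
    K = ∑ j ∈ Finset.range N, C ((B j).eval w) * A j := by
  obtain ⟨c, hc⟩ := exists_eq_sum_of_degree_eq hAB.degree_left hK
  rw [hc]
  refine Finset.sum_congr rfl fun k hk => ?_
  rw [← hKw k (Finset.mem_range.1 hk), hc, h.cauchyPairing_sum]
  simp only [hAB.pairing, mul_ite, mul_one, mul_zero, Finset.sum_ite_eq', hk, if_true]

end NikishinPair

/-! ### Columns of the solution and rows of its inverse -/

/-- The vector of values at `z` of a vector of polynomials. -/
def evalVec (P : Fin 3 → ℂ[X]) (z : ℂ) : Fin 3 → ℂ := fun i => (P i).eval z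

/-- The second column of a solution with first column `P`. -/
def middleColumn (a : ℝ → ℂ) (P : Fin 3 → ℂ[X]) (z : ℂ) : Fin 3 → ℂ :=
  Pi.single 1 1 + fun i => secondKind a (P i) z

/-- The density of the jump of the third column of a solution with first column `P`. -/
def lastDensity (a b : ℝ → ℂ) (P : Fin 3 → ℂ[X]) (i : Fin 3) (t : ℝ) : ℂ :=
  middleColumn a P t i * b t

/-- The third column of a solution with first column `P`; the polynomials `R` are its entire
part. -/
def lastColumn (a b : ℝ → ℂ) (P R : Fin 3 → ℂ[X]) (z : ℂ) : Fin 3 → ℂ :=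
  evalVec R z + fun i => cauchyTransform (lastDensity a b P i) z

/-- The polynomials `W` are the cross product of the first two columns, that is, the third row of
the inverse matrix. -/
def IsCrossPolynomial (a : ℝ → ℂ) (P W : Fin 3 → ℂ[X]) : Prop :=
  ∀ z, IsSeparated a z → evalVec W z = evalVec P z ⨯₃ middleColumn a P z

/-- The columns `P`, `middleColumn a P`, `lastColumn a b P R` satisfy the normalization
`diag (z ^ N, 1, z ^ (-N))` at infinity, along the imaginary ray. The middle column does so
automatically. -/
structure IsNormalized (a b : ℝ → ℂ) (N : ℕ) (P R : Fin 3 → ℂ[X]) : Prop where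
  tendsto_first : Tendsto (fun z => (z ^ N)⁻¹ • evalVec P z) imaginaryRay (𝓝 (Pi.single 0 1))
  tendsto_last :
    Tendsto (fun z => z ^ N • lastColumn a b P R z) imaginaryRay (𝓝 (Pi.single 2 1))

section Columns

variable {a b : ℝ → ℂ} {P R W : Fin 3 → ℂ[X]} {z : ℂ}

theorem continuous_evalVec (P : Fin 3 → ℂ[X]) : Continuous (evalVec P) :=
  continuous_pi fun i => (P i).continuous

theorem dotProduct_evalVec (x : Fin 3 → ℂ) (P : Fin 3 → ℂ[X]) (z : ℂ) :
    x ⬝ᵥ evalVec P z = (∑ i, C (x i) * P i).eval z := by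
  simp only [dotProduct, evalVec, eval_finsetSum, eval_mul, eval_C]

theorem dotProduct_middleColumn (ha : HasMoments a) (hz : IsSeparated a z) (x : Fin 3 → ℂ)
    (P : Fin 3 → ℂ[X]) :
    x ⬝ᵥ middleColumn a P z = x 1 + secondKind a (∑ i, C (x i) * P i) z := by
  rw [middleColumn, dotProduct_add, dotProduct_single, mul_one, secondKind_sum ha hz]
  rfl

theorem tendsto_middleColumn (ha : HasMoments a) (P : Fin 3 → ℂ[X]) :
    Tendsto (middleColumn a P) imaginaryRay (𝓝 (Pi.single 1 1)) := by
  have hzero : Tendsto (fun z i => secondKind a (P i) z) imaginaryRay (𝓝 0) :=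
    tendsto_pi_nhds.2 fun i =>
      tendsto_cauchyTransform_imaginaryRay (ha.polynomial_mul (P i)).integrable
  simpa only [add_zero] using! hzero.const_add (Pi.single 1 1)

theorem exists_polynomial_eval_mul_secondKind_sub (ha : HasMoments a) (f g : ℂ[X]) :
    ∃ D : ℂ[X], ∀ z, IsSeparated a z →
      f.eval z * secondKind a g z - g.eval z * secondKind a f z = D.eval z := by
  obtain ⟨D, hD⟩ := exists_polynomial_mul_cauchyTransform (ha.polynomial_mul g) f
  obtain ⟨E, hE⟩ := exists_polynomial_mul_cauchyTransform (ha.polynomial_mul f) g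
  refine ⟨D - E, fun z hz => ?_⟩
  simp only [secondKind, hD z (hz.mul_left _), hE z (hz.mul_left _), eval_sub,
    mul_left_comm (eval _ f)]
  ring

theorem exists_isCrossPolynomial (ha : HasMoments a) (P : Fin 3 → ℂ[X]) :
    ∃ W, IsCrossPolynomial a P W := by
  choose D hD using fun i j => exists_polynomial_eval_mul_secondKind_sub ha (P i) (P j)
  refine ⟨![-P 2, 0, P 0] + ![D 1 2, D 2 0, D 0 1], fun z hz => ?_⟩
  ext i
  fin_cases i <;> simp [evalVec, cross_apply, middleColumn, ← hD _ _ z hz] <;> ring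

theorem IsNikishinPair.hasMoments_lastDensity (h : IsNikishinPair a b) (P : Fin 3 → ℂ[X])
    (i : Fin 3) : HasMoments (lastDensity a b P i) := by
  intro n
  have hsecond := h.integrable_secondKind_mul (P i) (X ^ n)
  simp only [eval_pow, eval_X] at hsecond
  refine (((h.moments_right n).const_mul ((Pi.single 1 1 : Fin 3 → ℂ) i)).add hsecond).congr
    (.of_forall fun t => ?_)
  simp only [Pi.add_apply, lastDensity, middleColumn]
  ring

theorem IsNikishinPair.dotProduct_lastColumn_of_tendsto (h : IsNikishinPair a b)
    (f : Fin 3 → ℂ[X]) {L : ℂ}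
    (hL : Tendsto (fun z => evalVec f z ⬝ᵥ lastColumn a b P R z) imaginaryRay (𝓝 L))
    (hz : IsSeparated b z) :
    evalVec f z ⬝ᵥ lastColumn a b P R z =
      L + cauchyTransform (fun t : ℝ => (evalVec f t ⬝ᵥ middleColumn a P t) * b t) z := by
  have hσ := h.hasMoments_lastDensity P
  choose D hD using fun i => exists_polynomial_mul_cauchyTransform (hσ i) (f i)
  have hterm (i : Fin 3) := ((hσ i).polynomial_mul (f i)).integrable
  have hdens : (fun t : ℝ => (evalVec f t ⬝ᵥ middleColumn a P t) * b t) =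
      fun t : ℝ => ∑ i, (f i).eval (t : ℂ) * lastDensity a b P i t := by
    simp only [dotProduct, evalVec, lastDensity, Finset.sum_mul, mul_assoc]
  have hexpand {z : ℂ} (hz : IsSeparated b z) : evalVec f z ⬝ᵥ lastColumn a b P R z =
      (∑ i, (f i * R i + D i)).eval z +
        cauchyTransform (fun t : ℝ => ∑ i, (f i).eval (t : ℂ) * lastDensity a b P i t) z := by
    have hsep (i : Fin 3) : IsSeparated (lastDensity a b P i) z := hz.mul_left _
    rw [cauchyTransform_sum _ (fun i _ => hterm i) fun i _ => (hsep i).mul_left _,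
      eval_finsetSum, ← Finset.sum_add_distrib]
    refine Finset.sum_congr rfl fun i _ => ?_
    simp only [lastColumn, evalVec, Pi.add_apply, mul_add, eval_add, eval_mul, add_assoc,
      hD i z (hsep i)]
  have hconst := eq_C_of_tendsto_add_cauchyTransform (integrable_finsetSum _ fun i _ => hterm i)
    (hL.congr' (eventually_imaginaryRay_mem_offReal.mono fun w hw =>
      hexpand (isSeparated_of_mem_offReal b hw)))
  rw [hdens, hexpand hz, hconst, eval_C]

theorem IsCrossPolynomial.dotProduct_first (hW : IsCrossPolynomial a P W) (hz : IsSeparated a z) :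
    evalVec W z ⬝ᵥ evalVec P z = 0 := by
  rw [hW z hz, dotProduct_comm, dot_self_cross]

theorem IsCrossPolynomial.dotProduct_middle (hW : IsCrossPolynomial a P W)
    (hz : IsSeparated a z) : evalVec W z ⬝ᵥ middleColumn a P z = 0 := by
  rw [hW z hz, dotProduct_comm, dot_cross_self]

end Columns

section Rows

variable {a b : ℝ → ℂ} {N : ℕ} {P R W : Fin 3 → ℂ[X]} {z : ℂ}

theorem continuous_cross_dotProduct : Continuous fun x : (Fin 3 → ℂ) × (Fin 3 → ℂ) × (Fin 3 → ℂ) =>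
    (x.1 ⨯₃ x.2.1) ⬝ᵥ x.2.2 := by
  simp only [cross_apply]
  fun_prop

theorem IsNormalized.tendsto_cross_dotProduct_last (hn : IsNormalized a b N P R)
    {v : ℂ → Fin 3 → ℂ} {v₀ : Fin 3 → ℂ} (hv : Tendsto v imaginaryRay (𝓝 v₀)) :
    Tendsto (fun z => (evalVec P z ⨯₃ v z) ⬝ᵥ lastColumn a b P R z) imaginaryRay (𝓝 (v₀ 1)) := by
  have hlim := (continuous_cross_dotProduct.tendsto _).comp
    (hn.tendsto_first.prodMk_nhds (hv.prodMk_nhds hn.tendsto_last))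
  have hv₀ : (Pi.single 0 1 ⨯₃ v₀) ⬝ᵥ Pi.single 2 1 = v₀ 1 := by simp [cross_apply]
  rw [hv₀] at hlim
  refine hlim.congr' ?_
  filter_upwards [eventually_ne_zero_of_le_cobounded imaginaryRay_le_cobounded] with z hz
  simp [hz]

theorem IsNormalized.dotProduct_last (hn : IsNormalized a b N P R) (h : IsNikishinPair a b)
    (hW : IsCrossPolynomial a P W) (hz : IsSeparated b z) :
    evalVec W z ⬝ᵥ lastColumn a b P R z = 1 := by
  have hlim : Tendsto (fun z => evalVec W z ⬝ᵥ lastColumn a b P R z) imaginaryRay (𝓝 1) := by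
    refine (hn.tendsto_cross_dotProduct_last (tendsto_middleColumn h.moments_left P)).congr'
      (eventually_imaginaryRay_mem_offReal.mono fun z hz => ?_)
    simp only [hW z (isSeparated_of_mem_offReal a hz)]
  have hdens : (fun t : ℝ => (evalVec W t ⬝ᵥ middleColumn a P t) * b t) =ᵐ[volume]
      fun t => 0 * b t := h.mul_ae_eq fun t ht => hW.dotProduct_middle ht
  rw [h.dotProduct_lastColumn_of_tendsto W hlim hz, cauchyTransform_congr_ae hdens z,
    cauchyTransform_const_mul, zero_mul, add_zero]

/-- The left-hand side is `(P ⨯₃ v) ⬝ᵥ lastColumn a b P R`, and the density of its jump is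
`((P ⨯₃ v) ⬝ᵥ middleColumn a P) * b = -(W ⬝ᵥ v) * b`. -/
theorem IsNormalized.last_cross_first_dotProduct (hn : IsNormalized a b N P R)
    (h : IsNikishinPair a b) (hW : IsCrossPolynomial a P W) (hz : IsSeparated b z) (v : Fin 3 → ℂ) :
    (lastColumn a b P R z ⨯₃ evalVec P z) ⬝ᵥ v = v 1 - secondKind b (∑ i, C (v i) * W i) z := by
  have heval (w : ℂ) : evalVec (P ⨯₃ fun i => C (v i)) w = evalVec P w ⨯₃ v := by
    ext i
    fin_cases i <;> simp [evalVec, cross_apply]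
  have hlim : Tendsto (fun w => evalVec (P ⨯₃ fun i => C (v i)) w ⬝ᵥ lastColumn a b P R w)
      imaginaryRay (𝓝 (v 1)) := by
    simpa only [heval] using hn.tendsto_cross_dotProduct_last tendsto_const_nhds
  have hdens : (fun t : ℝ => (evalVec (P ⨯₃ fun i => C (v i)) t ⬝ᵥ middleColumn a P t) * b t)
      =ᵐ[volume] fun t => -(∑ i, C (v i) * W i).eval (t : ℂ) * b t := by
    refine h.mul_ae_eq fun t ht => ?_
    rw [heval, ← dotProduct_evalVec, hW t ht, triple_product_permutation,
      triple_product_permutation, ← cross_anticomm (evalVec P t) v, dotProduct_neg, neg_neg,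
      dotProduct_comm]
  simp only [← neg_one_mul (eval _ _), mul_assoc] at hdens
  rw [dotProduct_comm, triple_product_permutation, dotProduct_comm, ← heval,
    h.dotProduct_lastColumn_of_tendsto _ hlim hz, cauchyTransform_congr_ae hdens z,
    cauchyTransform_const_mul, neg_one_mul, ← sub_eq_add_neg, secondKind]

theorem IsNormalized.eval_mul_dotProduct_lastColumn (hn : IsNormalized a b N P R)
    (h : IsNikishinPair a b) {g : ℂ[X]} (hg : g.degree < N) (x : Fin 3 → ℂ) (hz : IsSeparated b z) :
    g.eval z * (x ⬝ᵥ lastColumn a b P R z) =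
      cauchyTransform (fun t : ℝ => g.eval (t : ℂ) * (x ⬝ᵥ middleColumn a P t) * b t) z := by
  have heval (w : ℂ) : evalVec (fun i => C (x i) * g) w = g.eval w • x := by
    ext i
    simp [evalVec, mul_comm]
  have hlim : Tendsto (fun z => evalVec (fun i => C (x i) * g) z ⬝ᵥ lastColumn a b P R z)
      imaginaryRay (𝓝 0) := by
    have hdot := ((continuous_const (y := x)).dotProduct continuous_id).continuousAt.tendsto.comp
      hn.tendsto_last
    have hmul := (tendsto_eval_div_pow_of_degree_lt imaginaryRay_le_cobounded hg).mul hdot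
    rw [zero_mul] at hmul
    refine hmul.congr' ?_
    filter_upwards [eventually_ne_zero_of_le_cobounded imaginaryRay_le_cobounded] with z hz
    simp only [heval, Function.comp_apply, dotProduct_smul, smul_dotProduct, smul_eq_mul, id]
    field_simp
  simpa only [heval, smul_dotProduct, smul_eq_mul, zero_add] using
    h.dotProduct_lastColumn_of_tendsto _ hlim hz

end Rows

/-! ### Christoffel-Darboux identities -/

section ChristoffelDarboux

variable {a b : ℝ → ℂ} {N : ℕ} {P R W : Fin 3 → ℂ[X]} {A B : ℕ → ℂ[X]} {z w : ℂ}

theorem secondKind_X_sub_C_mul_sub {ρ : ℝ → ℂ} (hρ : HasMoments ρ) (hz : IsSeparated ρ z)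
    (hw : IsSeparated ρ w) (f : ℂ[X]) :
    secondKind ρ ((X - C w) * f) z - secondKind ρ ((X - C w) * f) w =
      (z - w) * secondKind ρ f z := by
  rw [secondKind_X_sub_C_mul hρ hz, secondKind_X_sub_C_mul hρ hw]
  ring

theorem IsNormalized.degree_first_le (hn : IsNormalized a b N P R) (i : Fin 3) :
    (P i).degree ≤ N := by
  refine degree_le_of_tendsto_eval_div_pow imaginaryRay_le_cobounded
    ((tendsto_pi_nhds.1 hn.tendsto_first i).congr fun z => ?_)
  simp only [Pi.smul_apply, evalVec, smul_eq_mul, div_eq_inv_mul]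

theorem IsCrossPolynomial.dotProduct_middle_of_eq_mul (hW : IsCrossPolynomial a P W)
    (ha : HasMoments a) (hw : IsSeparated a w) {K : ℂ[X]}
    (hK : ∑ i, C ((W i).eval w) * P i = (X - C w) * K) (hz : IsSeparated a z) :
    evalVec W w ⬝ᵥ middleColumn a P z = (z - w) * secondKind a K z := by
  have hzero := hW.dotProduct_middle hw
  rw [dotProduct_middleColumn ha hw] at hzero
  rw [dotProduct_middleColumn ha hz, ← sub_zero (_ + _), ← hzero,
    ← secondKind_X_sub_C_mul_sub ha hz hw, ← hK]
  simp only [evalVec]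
  ring

theorem IsNormalized.exists_thirdRow_quotient (hn : IsNormalized a b N P R)
    (hW : IsCrossPolynomial a P W) (hw : IsSeparated a w) :
    ∃ K : ℂ[X], K.degree < N ∧ ∑ i, C ((W i).eval w) * P i = (X - C w) * K := by
  have hroot : (∑ i, C ((W i).eval w) * P i).IsRoot w :=
    (dotProduct_evalVec _ _ _).symm.trans (hW.dotProduct_first hw)
  obtain ⟨K, hK⟩ := dvd_iff_isRoot.2 hroot
  refine ⟨K, ?_, hK⟩
  have hdeg : ((X - C w) * K).degree ≤ (N : WithBot ℕ) := by
    rw [← hK]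
    refine (degree_sum_le _ _).trans (Finset.sup_le fun i _ => ?_)
    rw [C_mul']
    exact (degree_smul_le _ _).trans (hn.degree_first_le i)
  rcases eq_or_ne K 0 with rfl | hK0
  · exact degree_zero.trans_lt (WithBot.bot_lt_coe N)
  · rw [degree_mul, degree_X_sub_C, degree_eq_natDegree hK0] at hdeg
    rw [degree_eq_natDegree hK0]
    norm_cast at hdeg ⊢
    omega

/-- Reproducing property of the quotient: expand `W(w) ⬝ᵥ lastColumn(w) = 1` as a Cauchy
transform. -/
theorem IsNormalized.cauchyPairing_thirdRow_quotient (hn : IsNormalized a b N P R)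
    (h : IsNikishinPair a b) (hW : IsCrossPolynomial a P W) (hw : w ∈ offReal) {K g : ℂ[X]}
    (hK : ∑ i, C ((W i).eval w) * P i = (X - C w) * K) (hg : g.degree < N) :
    cauchyPairing a b K g = g.eval w := by
  have hwb := isSeparated_of_mem_offReal b hw
  have hlast := hn.eval_mul_dotProduct_lastColumn h hg (evalVec W w) hwb
  rw [hn.dotProduct_last h hW hwb, mul_one] at hlast
  rw [hlast, cauchyPairing, ← integral_neg, cauchyTransform]
  have hdens : (fun t : ℝ => -secondKind a K t * g.eval (t : ℂ) * b t) =ᵐ[volume]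
      fun t => g.eval (t : ℂ) * (evalVec W w ⬝ᵥ middleColumn a P t) / (w - t) * b t := by
    refine h.mul_ae_eq fun t ht => ?_
    have hwt : w - t ≠ 0 := fun h0 => sub_ofReal_mem_offReal hw t (by rw [h0, Complex.zero_im])
    rw [hW.dotProduct_middle_of_eq_mul h.moments_left (isSeparated_of_mem_offReal a hw) hK ht]
    field_simp
    ring
  exact integral_congr_ae (hdens.mono fun t ht => by linear_combination ht)

theorem IsNormalized.sum_thirdRow_mul_eq (hn : IsNormalized a b N P R)
    (h : IsNikishinPair a b) (hW : IsCrossPolynomial a P W)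
    (hAB : IsBiorthonormal a b A B) (hw : w ∈ offReal) :
    ∑ i, C ((W i).eval w) * P i =
      (X - C w) * ∑ j ∈ Finset.range N, C ((B j).eval w) * A j := by
  obtain ⟨K, hdeg, hK⟩ := hn.exists_thirdRow_quotient hW (isSeparated_of_mem_offReal a hw)
  rw [hK, hAB.eq_sum_of_reproducing h hdeg fun k hk =>
    hn.cauchyPairing_thirdRow_quotient h hW hw hK ?_]
  rw [hAB.degree_right]
  exact_mod_cast hk

theorem IsNormalized.thirdRow_dotProduct_first (hn : IsNormalized a b N P R)
    (h : IsNikishinPair a b) (hW : IsCrossPolynomial a P W)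
    (hAB : IsBiorthonormal a b A B) (z w : ℂ) :
    evalVec W w ⬝ᵥ evalVec P z =
      (z - w) * ∑ j ∈ Finset.range N, (B j).eval w * (A j).eval z := by
  refine congrFun (Continuous.ext_on dense_offReal
    ((continuous_evalVec W).dotProduct continuous_const) (g := fun w =>
      (z - w) * ∑ j ∈ Finset.range N, (B j).eval w * (A j).eval z) (by fun_prop) fun w hw => ?_) w
  simp only [dotProduct_evalVec, evalVec, hn.sum_thirdRow_mul_eq h hW hAB hw, eval_mul,
    eval_sub, eval_X, eval_C, eval_finsetSum]

theorem IsNormalized.thirdRow_dotProduct_middle (hn : IsNormalized a b N P R)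
    (h : IsNikishinPair a b) (hW : IsCrossPolynomial a P W)
    (hAB : IsBiorthonormal a b A B) (hz : IsSeparated a z) (w : ℂ) :
    evalVec W w ⬝ᵥ middleColumn a P z =
      (z - w) * ∑ j ∈ Finset.range N, (B j).eval w * secondKind a (A j) z := by
  refine congrFun (Continuous.ext_on dense_offReal
    ((continuous_evalVec W).dotProduct continuous_const) (g := fun w =>
      (z - w) * ∑ j ∈ Finset.range N, (B j).eval w * secondKind a (A j) z) (by fun_prop)
    fun w hw => ?_) w
  rw [hW.dotProduct_middle_of_eq_mul h.moments_left (isSeparated_of_mem_offReal a hw)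
    (hn.sum_thirdRow_mul_eq h hW hAB hw) hz, secondKind_sum h.moments_left hz]

theorem IsNormalized.secondRow_dotProduct_sub (hn : IsNormalized a b N P R)
    (h : IsNikishinPair a b) (hW : IsCrossPolynomial a P W)
    {v : Fin 3 → ℂ} {d : ℕ → ℂ} (hz : IsSeparated b z) (hw : IsSeparated b w)
    (hv : ∀ t, evalVec W t ⬝ᵥ v =
      (z - t) * ∑ j ∈ Finset.range N, (B j).eval t * d j) :
    (lastColumn a b P R w ⨯₃ evalVec P w) ⬝ᵥ v - (lastColumn a b P R z ⨯₃ evalVec P z) ⬝ᵥ v =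
      -((z - w) * ∑ j ∈ Finset.range N, secondKind b (B j) w * d j) := by
  have hpoly : ∑ i, C (v i) * W i =
      (X - C z) * ∑ j ∈ Finset.range N, C (-d j) * B j := by
    refine Polynomial.funext fun t => ?_
    rw [← dotProduct_evalVec, dotProduct_comm, hv]
    simp only [eval_mul, eval_sub, eval_X, eval_C, eval_finsetSum, neg_mul,
      Finset.sum_neg_distrib, mul_comm (d _)]
    ring
  rw [hn.last_cross_first_dotProduct h hW hw, hn.last_cross_first_dotProduct h hW hz, hpoly]
  have hsub := secondKind_X_sub_C_mul_sub h.moments_right hw hz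
    (∑ j ∈ Finset.range N, C (-d j) * B j)
  rw [secondKind_sum h.moments_right hw] at hsub
  simp only [neg_mul, Finset.sum_neg_distrib, mul_comm (d _)] at hsub
  linear_combination -hsub

theorem IsNormalized.secondRow_dotProduct_first (hn : IsNormalized a b N P R)
    (h : IsNikishinPair a b) (hW : IsCrossPolynomial a P W)
    (hAB : IsBiorthonormal a b A B) (hz : IsSeparated b z) (hw : IsSeparated b w) :
    (lastColumn a b P R w ⨯₃ evalVec P w) ⬝ᵥ evalVec P z =
      -((z - w) * ∑ j ∈ Finset.range N, secondKind b (B j) w * (A j).eval z) := by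
  rw [← hn.secondRow_dotProduct_sub h hW hz hw (hn.thirdRow_dotProduct_first h hW hAB z),
    dotProduct_comm _ (evalVec P z), dotProduct_comm (_ ⨯₃ evalVec P z), dot_cross_self,
    sub_zero, dotProduct_comm]

theorem IsNormalized.secondRow_dotProduct_middle (hn : IsNormalized a b N P R)
    (h : IsNikishinPair a b) (hW : IsCrossPolynomial a P W)
    (hAB : IsBiorthonormal a b A B) (hza : IsSeparated a z) (hzb : IsSeparated b z)
    (hw : IsSeparated b w) :
    (lastColumn a b P R w ⨯₃ evalVec P w) ⬝ᵥ middleColumn a P z =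
      1 - (z - w) * ∑ j ∈ Finset.range N, secondKind b (B j) w * secondKind a (A j) z := by
  have hdet : (lastColumn a b P R z ⨯₃ evalVec P z) ⬝ᵥ middleColumn a P z = 1 := by
    rw [dotProduct_comm, triple_product_permutation, ← hW z hza, dotProduct_comm,
      hn.dotProduct_last h hW hzb]
  rw [← hdet, sub_eq_add_neg,
    ← hn.secondRow_dotProduct_sub h hW hzb hw (hn.thirdRow_dotProduct_middle h hW hAB hza),
    add_sub_cancel]

end ChristoffelDarboux

/-! ### Positive densities as a Nikishin pair -/

theorem integral_Ioi_eq_integral {E : Type*} [NormedAddCommGroup E] [NormedSpace ℝ E]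
    {f : ℝ → E} (hf : ∀ x < 0, f x = 0) : ∫ x in Set.Ioi (0 : ℝ), f x = ∫ x, f x := by
  rw [← integral_Ici_eq_integral_Ioi]
  exact setIntegral_eq_integral_of_forall_compl_eq_zero fun x hx => hf x (by simpa using hx)

theorem HasMoments.comp_neg {ρ : ℝ → ℂ} (h : HasMoments ρ) : HasMoments fun t => ρ (-t) := by
  intro n
  refine ((h n).comp_neg.const_mul ((-1) ^ n)).congr (Eventually.of_forall fun t => ?_)
  simp only [Complex.ofReal_neg, ← mul_assoc, ← mul_pow, neg_mul, one_mul, neg_neg]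

/-- A real polynomial as a complex polynomial. -/
def complexify (f : ℝ[X]) : ℂ[X] := f.map (algebraMap ℝ ℂ)

/-- The complex polynomial `f(-z)`. It belongs to the reflected density `ρ(-t)`. -/
def reflectedPolynomial (f : ℝ[X]) : ℂ[X] := (complexify f).comp (-X)

theorem eval_complexify (f : ℝ[X]) (z : ℂ) : (complexify f).eval z = aeval z f :=
  eval_map_algebraMap f z

theorem eval_complexify_ofReal (f : ℝ[X]) (t : ℝ) :
    (complexify f).eval (t : ℂ) = (f.eval t : ℝ) :=
  eval_map_apply (algebraMap ℝ ℂ) t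

theorem eval_reflectedPolynomial (f : ℝ[X]) (z : ℂ) :
    (reflectedPolynomial f).eval z = (complexify f).eval (-z) := by
  simp only [reflectedPolynomial, eval_comp, eval_neg, eval_X]

section Densities

variable {α β : ℝ → ℝ} {p q : ℕ → ℝ[X]}

theorem IsDensityPair.symm (h : IsDensityPair α β) : IsDensityPair β α where
  nonneg_left := h.nonneg_right
  nonneg_right := h.nonneg_left
  supp_left := h.supp_right
  supp_right := h.supp_left
  integrable_left := h.integrable_right
  integrable_right := h.integrable_left
  bimoments i j := by
    refine (h.bimoments j i).swap.congr (Eventually.of_forall fun P => ?_)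
    simp only [Function.comp, Prod.fst_swap, Prod.snd_swap, add_comm P.2 P.1]
    ring

/-- `xⁿ α(x)` is a combination of the integrands of two bimoments at any fixed `y` with `β(y) ≠ 0`,
since `x + y` divides `xⁿ⁺¹ + y xⁿ`. -/
theorem IsDensityPair.hasMoments_left (h : IsDensityPair α β) (hβ : ¬ β =ᵐ[volume] 0) :
    HasMoments fun t => (α t : ℂ) := by
  intro n
  obtain ⟨y, hy, hn, hn_succ⟩ : ∃ y : ℝ, β y ≠ 0 ∧
      Integrable (fun x : ℝ => x ^ n * y ^ 0 / (x + y) * (α x * β y)) ∧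
      Integrable (fun x : ℝ => x ^ (n + 1) * y ^ 0 / (x + y) * (α x * β y)) := by
    by_contra! hcon
    refine hβ ?_
    filter_upwards [(h.bimoments n 0).prod_left_ae, (h.bimoments (n + 1) 0).prod_left_ae]
      with y hn hn_succ
    by_contra hy
    exact hcon y hy hn hn_succ
  have hint : Integrable fun x : ℝ => x ^ n * α x := by
    refine ((hn_succ.add (hn.const_mul y)).mul_const (β y)⁻¹).congr ?_
    filter_upwards [Measure.ae_ne volume (-y)] with x hx
    have hxy : x + y ≠ 0 := fun h0 => hx (eq_neg_of_add_eq_zero_left h0)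
    simp only [Pi.add_apply]
    field_simp
    ring
  simpa using hint.ofReal (𝕜 := ℂ)

theorem IsCauchyBOP.left_not_ae_zero (h : IsCauchyBOP α β p q) : ¬ α =ᵐ[volume] 0 := by
  intro hα
  refine one_ne_zero ((h.biorthonormal 0 0).symm.trans (integral_eq_zero_of_ae ?_))
  filter_upwards [ae_restrict_of_ae hα] with x hx
  simp [hx]

theorem IsCauchyBOP.right_not_ae_zero (h : IsCauchyBOP α β p q) : ¬ β =ᵐ[volume] 0 := by
  intro hβ
  refine one_ne_zero ((h.biorthonormal 0 0).symm.trans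
    (integral_eq_zero_of_ae (Eventually.of_forall fun x => integral_eq_zero_of_ae ?_)))
  filter_upwards [ae_restrict_of_ae hβ] with y hy
  simp [hy]

theorem IsDensityPair.integrable_reflected_bimoment (h : IsDensityPair α β) (i j : ℕ) :
    Integrable (fun P : ℝ × ℝ => (P.1 : ℂ) ^ i * α P.1 / ((P.2 : ℂ) - P.1) *
      ((P.2 : ℂ) ^ j * reflected β P.2)) (volume.prod volume) := by
  have hneg : MeasurePreserving (fun P : ℝ × ℝ => (P.1, -P.2)) (volume.prod volume)
      (volume.prod volume) :=
    (MeasurePreserving.id volume).prod (Measure.measurePreserving_neg volume)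
  have hint := (hneg.integrable_comp (h.bimoments i j).aestronglyMeasurable).2 (h.bimoments i j)
  refine ((hint.ofReal (𝕜 := ℂ)).const_mul (-(-1) ^ j)).congr (Eventually.of_forall fun P => ?_)
  simp only [Function.comp, reflected, RCLike.ofReal_eq_complex_ofReal]
  push_cast
  have hsign : ((-1 : ℂ) ^ j) * (-1) ^ j = 1 := by rw [← mul_pow]; simp
  rw [show (P.1 : ℂ) + -P.2 = -((P.2 : ℂ) - P.1) by ring, neg_pow (P.2 : ℂ), div_neg]
  linear_combination ((P.1 : ℂ) ^ i * α P.1 / ((P.2 : ℂ) - P.1) *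
    ((P.2 : ℂ) ^ j * β (-P.2))) * hsign

theorem IsDensityPair.isNikishinPair (h : IsDensityPair α β) (hpq : IsCauchyBOP α β p q) :
    IsNikishinPair (fun t => (α t : ℂ)) (fun t => (reflected β t : ℂ)) where
  supp_left t ht := by simp [h.supp_left t ht]
  supp_right t ht := by simp [reflected, h.supp_right (-t) (neg_neg_of_pos ht)]
  moments_left := h.hasMoments_left hpq.right_not_ae_zero
  moments_right := (h.symm.hasMoments_left hpq.left_not_ae_zero).comp_neg
  bimoments := h.integrable_reflected_bimoment

theorem integral_reflectedPolynomial_mul (α : ℝ → ℝ) (hβ : ∀ y < 0, β y = 0) (f g : ℝ[X]) (x : ℝ) :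
    ∫ t : ℝ, (complexify f).eval (x : ℂ) * α x / ((t : ℂ) - x) *
      ((reflectedPolynomial g).eval (t : ℂ) * reflected β t) =
      ((-∫ y in Set.Ioi (0 : ℝ), f.eval x * g.eval y / (x + y) * (α x * β y) : ℝ) : ℂ) := by
  rw [integral_Ioi_eq_integral (fun y hy => by simp [hβ y hy]),
    ← integral_neg_eq_self, ← integral_neg, ← integral_complex_ofReal]
  congr 1 with y
  simp only [eval_reflectedPolynomial, reflected, Complex.ofReal_neg, neg_neg,
    eval_complexify_ofReal]
  push_cast
  rw [show -(y : ℂ) - x = -(x + y) by ring, div_neg]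
  ring

theorem IsDensityPair.cauchyPairing_eq (h : IsDensityPair α β) (hpq : IsCauchyBOP α β p q)
    (f g : ℝ[X]) :
    cauchyPairing (fun t => (α t : ℂ)) (fun t => (reflected β t : ℂ))
        (complexify f) (reflectedPolynomial g) =
      ((∫ x in Set.Ioi (0 : ℝ), ∫ y in Set.Ioi (0 : ℝ),
        f.eval x * g.eval y / (x + y) * (α x * β y) : ℝ) : ℂ) := by
  have hswap := integral_integral_swap (f := fun x t : ℝ =>
    (complexify f).eval (x : ℂ) * α x / ((t : ℂ) - x) *
      ((reflectedPolynomial g).eval (t : ℂ) * reflected β t))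
    ((h.isNikishinPair hpq).integrable_kernel (complexify f) (reflectedPolynomial g))
  simp only [integral_reflectedPolynomial_mul α h.supp_right, integral_mul_const] at hswap
  simp only [cauchyPairing, secondKind, cauchyTransform]
  rw [← hswap, integral_complex_ofReal, integral_neg, Complex.ofReal_neg, neg_neg,
    ← integral_Ioi_eq_integral fun x hx => by simp [h.supp_left x hx]]

theorem IsCauchyBOP.isBiorthonormal (hpq : IsCauchyBOP α β p q) (h : IsDensityPair α β) :
    IsBiorthonormal (fun t => (α t : ℂ)) (fun t => (reflected β t : ℂ))
      (fun j => complexify (p j)) fun j => reflectedPolynomial (q j) where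
  degree_left j := by
    have hp : p j ≠ 0 := leadingCoeff_ne_zero.1 (hpq.leadingCoeff_pos j).ne'
    rw [complexify, degree_map, degree_eq_natDegree hp, hpq.natDegree_left]
  degree_right j := by
    have hq : q j ≠ 0 := leadingCoeff_ne_zero.1 (hpq.leadingCoeff_eq j ▸ hpq.leadingCoeff_pos j).ne'
    rw [reflectedPolynomial, degree_comp_neg_X, complexify, degree_map, degree_eq_natDegree hq,
      hpq.natDegree_right]
  pairing j k := by
    rw [h.cauchyPairing_eq hpq, hpq.biorthonormal]
    split_ifs <;> simp

end Densities

/-! ### The solution of the Riemann-Hilbert problem -/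

section BoundaryValues

variable {a b r : ℝ → ℂ}

theorem tendsto_ofReal_sub_mul_I (x : ℝ) :
    Tendsto (fun ε : ℝ => (x : ℂ) - ε * I) (𝓝[>] 0) (𝓝 x) := by
  have hcont : Continuous fun ε : ℝ => (x : ℂ) - ε * I := by fun_prop
  simpa using tendsto_nhdsWithin_of_tendsto_nhds (hcont.tendsto 0)

theorem hasDominatedBoundaryValues_eval (hr : Integrable r) (f : ℂ[X]) :
    HasDominatedBoundaryValues f.eval r fun x => f.eval (x : ℂ) where
  dominated K hK := by
    obtain ⟨M, hM⟩ := (hK.prod (isCompact_Icc (a := (0 : ℝ)) (b := 1))).exists_bound_of_continuousOn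
      (f := fun y : ℝ × ℝ => f.eval ((y.1 : ℂ) - y.2 * I)) (Continuous.continuousOn (by fun_prop))
    refine ⟨fun x => M * ‖r x‖, hr.norm.const_mul M, .of_forall fun x hx ε hε => ?_⟩
    rw [norm_mul]
    exact mul_le_mul_of_nonneg_right (hM (x, ε) ⟨hx, hε.1.le, hε.2.le⟩) (norm_nonneg _)
  tendsto := .of_forall fun x =>
    (f.continuous.continuousAt.tendsto.comp (tendsto_ofReal_sub_mul_I x)).mul_const _

theorem IsNikishinPair.norm_middleColumn_mul_le (h : IsNikishinPair a b) (P : Fin 3 → ℂ[X])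
    (i : Fin 3) {t : ℝ} (ht : t < 0) (ε : ℝ)
    (hint : Integrable fun x : ℝ =>
      (P i).eval (x : ℂ) * a x / ((t : ℂ) - x) * ((1 : ℂ[X]).eval (t : ℂ) * b t)) :
    ‖middleColumn a P (t - ε * I) i * b t‖ ≤ ‖(Pi.single 1 1 : Fin 3 → ℂ) i‖ * ‖b t‖ +
      ∫ x : ℝ, ‖(P i).eval (x : ℂ) * a x / ((t : ℂ) - x) * ((1 : ℂ[X]).eval (t : ℂ) * b t)‖ := by
  rw [middleColumn, Pi.add_apply, add_mul, secondKind, cauchyTransform, ← integral_mul_const]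
  refine (norm_add_le _ _).trans (add_le_add (norm_mul _ _).le ?_)
  refine norm_integral_le_of_norm_le hint.norm (.of_forall fun x => ?_)
  by_cases hx : a x = 0
  · simp [hx]
  have hx0 : 0 ≤ x := le_of_not_gt fun hneg => hx (h.supp_left x hneg)
  have hpos : 0 < ‖(t : ℂ) - x‖ := by
    rw [norm_pos_iff, ← Complex.ofReal_sub]
    exact_mod_cast (by linarith : t - x < 0).ne
  have hle : ‖(t : ℂ) - x‖ ≤ ‖(t : ℂ) - ε * I - x‖ := by
    have hre := Complex.abs_re_le_norm ((t : ℂ) - ε * I - x)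
    rw [← Complex.ofReal_sub, Complex.norm_real, Real.norm_eq_abs]
    simpa using hre
  rw [norm_mul, norm_mul, norm_div, norm_div, eval_one, one_mul]
  gcongr

theorem continuousAt_middleColumn (ha : HasMoments a) (P : Fin 3 → ℂ[X]) {z : ℂ}
    (hz : IsSeparated a z) : ContinuousAt (middleColumn a P) z :=
  continuousAt_const.add (continuousAt_pi.2 fun i => continuousAt_secondKind ha (P i) hz)

theorem IsNikishinPair.continuousAt_lastColumn (h : IsNikishinPair a b) (P R : Fin 3 → ℂ[X])
    {z : ℂ} (hz : IsSeparated b z) : ContinuousAt (lastColumn a b P R) z :=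
  (continuous_evalVec R).continuousAt.add (continuousAt_pi.2 fun i =>
    (differentiableAt_cauchyTransform (h.hasMoments_lastDensity P i).integrable
      (hz.mul_left _)).continuousAt)

/-- The two densities are on different sides of the origin, so the middle column is bounded near
the support of `b` by the integrand of a bimoment. -/
theorem IsNikishinPair.hasDominatedBoundaryValues_middleColumn (h : IsNikishinPair a b)
    (P : Fin 3 → ℂ[X]) (i : Fin 3) :
    HasDominatedBoundaryValues (fun z => middleColumn a P z i) b
      fun t => middleColumn a P t i where
  dominated K _ := by
    have hker := h.integrable_kernel (P i) 1
    refine ⟨_, (h.moments_right.integrable.norm.const_mul ‖(Pi.single 1 1 : Fin 3 → ℂ) i‖).add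
      hker.norm.integral_prod_right, ?_⟩
    filter_upwards [hker.prod_left_ae, h.ae_neg_or_eq_zero] with t hint ht _ ε _
    rcases ht with ht | ht
    · exact h.norm_middleColumn_mul_le P i ht ε hint
    · simp [ht]
  tendsto := by
    filter_upwards [h.ae_neg_or_eq_zero] with t ht
    rcases ht with ht | ht
    · have hcont := continuousAt_middleColumn h.moments_left P (isSeparated_of_neg h.supp_left ht)
      exact ((hcont.tendsto.comp (tendsto_ofReal_sub_mul_I t)).apply_nhds i).mul_const _
    · simp [ht]

end BoundaryValues

section Solution

variable {α β : ℝ → ℝ} {N : ℕ} {Γ : ℂ → Matrix (Fin 3) (Fin 3) ℂ} {z : ℂ}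

theorem HasDominatedBoundaryValues.congr {f g : ℂ → ℂ} {r g₀ : ℝ → ℂ}
    (h : HasDominatedBoundaryValues g r g₀) (hfg : Set.EqOn f g offReal) :
    HasDominatedBoundaryValues f r g₀ where
  dominated K hK := by
    obtain ⟨B, hB, hle⟩ := h.dominated K hK
    refine ⟨B, hB, hle.mono fun x hx hxK ε hε => ?_⟩
    rw [hfg (ofReal_sub_mul_I_mem_offReal x hε.1.ne')]
    exact hx hxK ε hε
  tendsto := h.tendsto.mono fun x hx => hx.congr' <| by
    filter_upwards [self_mem_nhdsWithin] with ε hε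
    rw [hfg (ofReal_sub_mul_I_mem_offReal x (ne_of_gt hε))]

theorem offReal_subset_offSupports (α β : ℝ → ℝ) : offReal ⊆ offSupports α β := by
  rintro _ hz ⟨t, -, rfl⟩
  exact hz (Complex.ofReal_im t)

theorem isSeparated_left_of_mem_offSupports (hz : z ∈ offSupports α β) :
    IsSeparated (fun t => (α t : ℂ)) z :=
  isSeparated_of_notMem (isClosed_tsupport α)
    (fun _ ht => subset_tsupport α (Complex.ofReal_ne_zero.1 ht))
    fun ⟨t, ht, h⟩ => hz ⟨t, .inl ht, h⟩

theorem isSeparated_right_of_mem_offSupports (hz : z ∈ offSupports α β) :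
    IsSeparated (fun t => (reflected β t : ℂ)) z :=
  isSeparated_of_notMem (isClosed_tsupport (reflected β))
    (fun _ ht => subset_tsupport (reflected β) (Complex.ofReal_ne_zero.1 ht))
    fun ⟨t, ht, h⟩ => hz ⟨t, .inr ht, h⟩

theorem IsRHPSolution.differentiableOn_offReal (hΓ : IsRHPSolution α β N Γ) (i j : Fin 3) :
    DifferentiableOn ℂ (fun z => Γ z i j) offReal :=
  (hΓ.analytic i j).mono (offReal_subset_offSupports α β)

theorem IsRHPSolution.exists_hasSlowGrowth (hΓ : IsRHPSolution α β N Γ) :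
    ∃ k m, ∀ i j, HasSlowGrowth (fun z => Γ z i j) k m := by
  obtain ⟨A, k, m, hA⟩ := hΓ.slowGrowth
  refine ⟨k, m, fun i j => ⟨|A|, abs_nonneg A, fun z hz => (hA z hz i j).trans ?_⟩⟩
  gcongr
  exact le_abs_self A

theorem IsRHPSolution.tendsto_imaginaryRay (hΓ : IsRHPSolution α β N Γ) (j : Fin 3) :
    Tendsto (fun z => ![(z ^ N)⁻¹, 1, z ^ N] j • (Γ z).col j) imaginaryRay
      (𝓝 (Pi.single j 1)) := by
  have hsector : imaginaryRay ≤ Bornology.cobounded ℂ ⊓ 𝓟 {z : ℂ | 1 * ‖z‖ ≤ |z.im|} :=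
    le_inf imaginaryRay_le_cobounded (by simp [imaginaryRay])
  refine tendsto_pi_nhds.2 fun i => ?_
  have hlim := (((hΓ.asymptotics 1 one_pos i j).mono hsector).trans_tendsto
    (tendsto_inv₀_cobounded.mono_left imaginaryRay_le_cobounded)).add_const
    ((1 : Matrix (Fin 3) (Fin 3) ℂ) i j)
  simpa [Matrix.mul_diagonal, Matrix.one_apply, Pi.single_apply, mul_comm] using hlim

theorem IsRHPSolution.hasWeakJump_zero (hΓ : IsRHPSolution α β N Γ) (i : Fin 3) :
    HasWeakJump (fun z => Γ z i 0) 0 := fun φ hφ => by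
  simpa [Matrix.mul_apply, Fin.sum_univ_three, jumpMatrix] using
    hΓ.jump φ hφ.contDiff hφ.hasCompactSupport i 0

theorem IsRHPSolution.hasTriangularJump_one (hΓ : IsRHPSolution α β N Γ) (i : Fin 3) :
    HasTriangularJump (fun z => Γ z i 1) (fun z => Γ z i 0) fun t => (α t : ℂ) := fun φ hφ => by
  simpa [Matrix.mul_apply, Fin.sum_univ_three, jumpMatrix] using
    hΓ.jump φ hφ.contDiff hφ.hasCompactSupport i 1

theorem IsRHPSolution.hasTriangularJump_two (hΓ : IsRHPSolution α β N Γ) (i : Fin 3) :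
    HasTriangularJump (fun z => Γ z i 2) (fun z => Γ z i 1) fun t => (reflected β t : ℂ) :=
  fun φ hφ => by
  simpa [Matrix.mul_apply, Fin.sum_univ_three, jumpMatrix] using
    hΓ.jump φ hφ.contDiff hφ.hasCompactSupport i 2

theorem IsRHPSolution.exists_entry_eq (hΓ : IsRHPSolution α β N Γ) {i j k : Fin 3} {r g₀ : ℝ → ℂ}
    (hjump : HasTriangularJump (fun z => Γ z i k) (fun z => Γ z i j) r) (hr : Integrable r)
    (hb : HasDominatedBoundaryValues (fun z => Γ z i j) r g₀)
    (hg₀ : Integrable fun x => g₀ x * r x) :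
    ∃ Q : ℂ[X], ∀ z ∈ offReal, Γ z i k = Q.eval z + cauchyTransform (fun x => g₀ x * r x) z := by
  obtain ⟨_, _, hgrowth⟩ := hΓ.exists_hasSlowGrowth
  exact exists_polynomial_add_cauchyTransform (hΓ.differentiableOn_offReal i k) (hgrowth i k) hg₀
    (hjump.hasWeakJump (hΓ.differentiableOn_offReal i k).continuousOn
      (hΓ.differentiableOn_offReal i j).continuousOn hr.aestronglyMeasurable hb)

theorem IsRHPSolution.exists_firstColumn (hΓ : IsRHPSolution α β N Γ) :
    ∃ P : Fin 3 → ℂ[X], ∀ z ∈ offReal, (Γ z).col 0 = evalVec P z := by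
  obtain ⟨_, _, hgrowth⟩ := hΓ.exists_hasSlowGrowth
  choose P hP using fun i => exists_polynomial_of_hasWeakJump_zero
    (hΓ.differentiableOn_offReal i 0) (hgrowth i 0) (hΓ.hasWeakJump_zero i)
  exact ⟨P, fun z hz => funext fun i => hP i z hz⟩

theorem IsRHPSolution.middleColumn_eq (hΓ : IsRHPSolution α β N Γ)
    (hα : HasMoments fun t => (α t : ℂ)) {P : Fin 3 → ℂ[X]}
    (hP : ∀ z ∈ offReal, (Γ z).col 0 = evalVec P z) (hz : z ∈ offReal) :
    (Γ z).col 1 = middleColumn (fun t => (α t : ℂ)) P z := by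
  ext i
  have hint := (hα.polynomial_mul (P i)).integrable
  obtain ⟨Q, hQ⟩ := hΓ.exists_entry_eq (hΓ.hasTriangularJump_one i) hα.integrable
    ((hasDominatedBoundaryValues_eval hα.integrable (P i)).congr
      fun w hw => congrFun (hP w hw) i) hint
  have hlim := tendsto_pi_nhds.1 (hΓ.tendsto_imaginaryRay 1) i
  have hconst : Q = C ((Pi.single 1 1 : Fin 3 → ℂ) i) :=
    eq_C_of_tendsto_add_cauchyTransform hint <| hlim.congr' <|
      eventually_imaginaryRay_mem_offReal.mono fun w hw => by simpa using hQ w hw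
  simpa [hconst, middleColumn, secondKind] using hQ z hz

theorem IsRHPSolution.exists_lastColumn (hΓ : IsRHPSolution α β N Γ)
    (h : IsNikishinPair (fun t => (α t : ℂ)) fun t => (reflected β t : ℂ)) {P : Fin 3 → ℂ[X]}
    (hP : ∀ z ∈ offReal, (Γ z).col 1 = middleColumn (fun t => (α t : ℂ)) P z) :
    ∃ R, ∀ z ∈ offReal, (Γ z).col 2 =
      lastColumn (fun t => (α t : ℂ)) (fun t => (reflected β t : ℂ)) P R z := by
  choose R hR using fun i => hΓ.exists_entry_eq (hΓ.hasTriangularJump_two i)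
    h.moments_right.integrable
    ((h.hasDominatedBoundaryValues_middleColumn P i).congr fun w hw => congrFun (hP w hw) i)
    (h.hasMoments_lastDensity P i).integrable
  exact ⟨R, fun z hz => funext fun i => hR i z hz⟩

theorem IsRHPSolution.col_eq_of_eqOn_offReal (hΓ : IsRHPSolution α β N Γ) {j : Fin 3}
    {v : ℂ → Fin 3 → ℂ} (hv : ContinuousOn v (offSupports α β))
    (h : ∀ z ∈ offReal, (Γ z).col j = v z) (hz : z ∈ offSupports α β) : (Γ z).col j = v z :=
  Set.EqOn.of_subset_closure h (continuousOn_pi.2 fun i => (hΓ.analytic i j).continuousOn) hv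
    (offReal_subset_offSupports α β) (fun w _ => dense_offReal w) hz

theorem IsRHPSolution.exists_isNormalized (hΓ : IsRHPSolution α β N Γ)
    (h : IsNikishinPair (fun t => (α t : ℂ)) fun t => (reflected β t : ℂ)) :
    ∃ P R, IsNormalized (fun t => (α t : ℂ)) (fun t => (reflected β t : ℂ)) N P R ∧
      ∀ z ∈ offSupports α β, Γ z = (Matrix.of ![evalVec P z,
        middleColumn (fun t => (α t : ℂ)) P z,
        lastColumn (fun t => (α t : ℂ)) (fun t => (reflected β t : ℂ)) P R z])ᵀ := by
  obtain ⟨P, hP⟩ := hΓ.exists_firstColumn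
  have hmiddle (z : ℂ) (hz : z ∈ offReal) := hΓ.middleColumn_eq h.moments_left hP hz
  obtain ⟨R, hR⟩ := hΓ.exists_lastColumn h hmiddle
  refine ⟨P, R, ⟨?_, ?_⟩, fun z hz => ?_⟩
  · exact (hΓ.tendsto_imaginaryRay 0).congr' <|
      eventually_imaginaryRay_mem_offReal.mono fun z hz => by rw [hP z hz]; rfl
  · exact (hΓ.tendsto_imaginaryRay 2).congr' <|
      eventually_imaginaryRay_mem_offReal.mono fun z hz => by rw [hR z hz]; rfl
  · have hfirst := hΓ.col_eq_of_eqOn_offReal (continuous_evalVec P).continuousOn hP hz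
    have hsecond := hΓ.col_eq_of_eqOn_offReal (fun w hw => (continuousAt_middleColumn
      h.moments_left P (isSeparated_left_of_mem_offSupports hw)).continuousWithinAt) hmiddle hz
    have hthird := hΓ.col_eq_of_eqOn_offReal (fun w hw => (h.continuousAt_lastColumn P R
      (isSeparated_right_of_mem_offSupports hw)).continuousWithinAt) hR hz
    ext i j
    fin_cases j
    exacts [congrFun hfirst i, congrFun hsecond i, congrFun hthird i]

end Solution

theorem inv_transpose_of_cross {R : Type*} [CommRing R] {u v w : Fin 3 → R}
    (h : (u ⨯₃ v) ⬝ᵥ w = 1) :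
    (Matrix.of ![u, v, w])ᵀ⁻¹ = Matrix.of ![v ⨯₃ w, w ⨯₃ u, u ⨯₃ v] := by
  have hleft (x y : Fin 3 → R) : (x ⨯₃ y) ⬝ᵥ x = 0 := by rw [dotProduct_comm, dot_self_cross]
  have hright (x y : Fin 3 → R) : (x ⨯₃ y) ⬝ᵥ y = 0 := by rw [dotProduct_comm, dot_cross_self]
  have hrot (x y t : Fin 3 → R) : (y ⨯₃ t) ⬝ᵥ x = (x ⨯₃ y) ⬝ᵥ t := by
    rw [dotProduct_comm, triple_product_permutation, triple_product_permutation, dotProduct_comm]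
  refine Matrix.inv_eq_left_inv ?_
  ext i j
  fin_cases i <;> fin_cases j
  exacts [(hrot u v w).trans h, hleft v w, hright v w, hright w u,
    (hrot v w u).trans ((hrot u v w).trans h), hleft w u, hleft u v, hright u v, h]

/-! ### The kernels -/

section Kernels

variable {α β ρ : ℝ → ℝ} {p q : ℕ → ℝ[X]} {N : ℕ} {Γ : ℂ → Matrix (Fin 3) (Fin 3) ℂ} {z w : ℂ}

theorem transform_zero (ρ : ℝ → ℝ) (f : ℝ[X]) (z : ℂ) : transform ρ f 0 z = aeval z f := rfl

theorem transform_one_eq_secondKind (hρ : ∀ x < 0, ρ x = 0) (f : ℝ[X]) (z : ℂ) :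
    transform ρ f 1 z = secondKind (fun t => (ρ t : ℂ)) (complexify f) z := by
  rw [transform, integral_Ioi_eq_integral fun x hx => by simp [hρ x hx]]
  simp only [secondKind, cauchyTransform, eval_complexify_ofReal, Complex.ofReal_mul]

theorem transform_one_neg_eq_secondKind (hρ : ∀ x < 0, ρ x = 0) (f : ℝ[X]) (w : ℂ) :
    transform ρ f 1 (-w) =
      -secondKind (fun t => (reflected ρ t : ℂ)) (reflectedPolynomial f) w := by
  rw [transform_one_eq_secondKind hρ, secondKind, secondKind, cauchyTransform, cauchyTransform,
    ← integral_neg, ← integral_neg_eq_self]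
  congr with t
  rw [eval_reflectedPolynomial, reflected, ← div_neg, Complex.ofReal_neg]
  ring_nf

theorem continuousAt_transform (hm : HasMoments fun t => (ρ t : ℂ)) (hρ : ∀ x < 0, ρ x = 0)
    (f : ℝ[X]) {μ : Fin 2} {a : ℝ} (ha : μ = 1 → a < 0) : ContinuousAt (transform ρ f μ) a := by
  fin_cases μ
  · exact f.continuous_aeval.continuousAt
  · have hsep : IsSeparated (fun t => (ρ t : ℂ)) a :=
      isSeparated_of_neg (fun t ht => by simp [hρ t ht]) (ha rfl)
    exact (continuousAt_secondKind hm (complexify f) hsep).congr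
      (.of_forall fun z => (transform_one_eq_secondKind hρ f z).symm)

theorem continuousAt_matrixKernel (hα : ∀ x < 0, α x = 0) (hβ : ∀ x < 0, β x = 0)
    (hmα : HasMoments fun t => (α t : ℂ)) (hmβ : HasMoments fun t => (β t : ℂ)) {μ ν : Fin 2}
    {a b : ℝ} (ha : ν = 1 → a < 0) (hb : μ = 1 → b < 0) :
    ContinuousAt (fun x : ℂ × ℂ => matrixKernel α β p q N x.1 x.2 μ ν) (a, b) := by
  have hsum (j : ℕ) (_ : j ∈ Finset.range N) : ContinuousAt
      (fun x : ℂ × ℂ => transform β (q j) μ x.2 * transform α (p j) ν x.1) (a, b) :=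
    ((continuousAt_transform hmβ hβ (q j) hb).comp_of_eq continuousAt_snd rfl).mul
      ((continuousAt_transform hmα hα (p j) ha).comp_of_eq continuousAt_fst rfl)
  refine (tendsto_finsetSum _ hsum).add ?_
  by_cases hone : μ = 1 ∧ ν = 1
  · have hne : (a : ℂ) + b ≠ 0 := by exact_mod_cast (add_neg (ha hone.2) (hb hone.1)).ne
    exact ContinuousAt.div continuousAt_const (continuousAt_fst.add continuousAt_snd) hne
  · have hzero : (!![0, 0; 0, 1] : Matrix (Fin 2) (Fin 2) ℂ) μ ν = 0 := by
      fin_cases μ <;> fin_cases ν <;> simp at hone ⊢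
    simp only [hzero, zero_div]
    exact tendsto_const_nhds

theorem IsRHPSolution.inv_mul_apply_div (hΓ : IsRHPSolution α β N Γ) (h : IsDensityPair α β)
    (hpq : IsCauchyBOP α β p q) (hz : z ∈ offSupports α β) (hw : w ∈ offSupports α β)
    (hzw : z ≠ w) (μ ν : Fin 2) :
    ((Γ w)⁻¹ * Γ z) (![2, 1] μ) (![0, 1] ν) / (z - w) = matrixKernel α β p q N z (-w) μ ν := by
  have hab := h.isNikishinPair hpq
  have hAB := hpq.isBiorthonormal h
  obtain ⟨P, R, hn, hcol⟩ := hΓ.exists_isNormalized hab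
  obtain ⟨W, hW⟩ := exists_isCrossPolynomial hab.moments_left P
  have hza := isSeparated_left_of_mem_offSupports hz
  have hzb := isSeparated_right_of_mem_offSupports hz
  have hwa := isSeparated_left_of_mem_offSupports hw
  have hwb := isSeparated_right_of_mem_offSupports hw
  have hdet := hn.dotProduct_last hab hW hwb
  rw [hW w hwa] at hdet
  rw [hcol z hz, hcol w hw, inv_transpose_of_cross hdet, ← hW w hwa,
    div_eq_iff (sub_ne_zero.2 hzw), matrixKernel]
  have hentry00 := hn.thirdRow_dotProduct_first hab hW hAB z w
  have hentry01 := hn.thirdRow_dotProduct_middle hab hW hAB hza w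
  have hentry10 := hn.secondRow_dotProduct_first hab hW hAB hzb hwb
  have hentry11 := hn.secondRow_dotProduct_middle hab hW hAB hza hzb hwb
  fin_cases μ <;> fin_cases ν
  · refine hentry00.trans ?_
    simp [transform_zero, mul_comm (z - w), eval_complexify, eval_reflectedPolynomial]
  · refine hentry01.trans ?_
    simp [transform_zero, mul_comm (z - w), eval_complexify, eval_reflectedPolynomial,
      transform_one_eq_secondKind h.supp_left]
  · refine hentry10.trans ?_
    simp [transform_zero, mul_comm (z - w), eval_complexify,
      transform_one_neg_eq_secondKind h.supp_right]
  · have hcancel : 1 / (z + -w) * (z - w) = 1 := by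
      rw [← sub_eq_add_neg, one_div_mul_cancel (sub_ne_zero.2 hzw)]
    refine hentry11.trans ?_
    simp [-one_div, transform_one_eq_secondKind h.supp_left,
      transform_one_neg_eq_secondKind h.supp_right]
    linear_combination -hcancel

theorem IsRHPSolution.hasValue_matrixKernel (hΓ : IsRHPSolution α β N Γ) (h : IsDensityPair α β)
    (hpq : IsCauchyBOP α β p q) (μ ν : Fin 2) {a b : ℝ} (ha : ν = 1 → a < 0) (hb : μ = 1 → b < 0) :
    HasValue α β (fun z w => ((Γ w)⁻¹ * Γ z) (![2, 1] μ) (![0, 1] ν) / (z - w)) a (-b)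
      (matrixKernel α β p q N a b μ ν) := by
  have hcont : ContinuousAt (fun x : ℂ × ℂ => matrixKernel α β p q N x.1 (-x.2) μ ν) (a, -b) := by
    exact (continuousAt_matrixKernel h.supp_left h.supp_right
      (h.hasMoments_left hpq.right_not_ae_zero) (h.symm.hasMoments_left hpq.left_not_ae_zero)
      ha hb).comp_of_eq (f := fun x : ℂ × ℂ => (x.1, -x.2)) (by fun_prop) (by simp)
  have hlim := hcont.tendsto.mono_left (nhdsWithin_le_nhds (s := {x : ℂ × ℂ |
    x.1 ∈ offSupports α β ∧ x.2 ∈ offSupports α β ∧ x.1 ≠ x.2}))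
  simp only [neg_neg] at hlim
  refine hlim.congr' ?_
  filter_upwards [self_mem_nhdsWithin] with x hx
  exact (hΓ.inv_mul_apply_div h hpq hx.1 hx.2.1 hx.2.2 μ ν).symm

theorem HasValue.neg_div_sub {G : ℂ → ℂ → ℂ} {a b L : ℂ}
    (h : HasValue α β (fun z w => G z w / (z - w)) a b L) :
    HasValue α β (fun z w => G z w / (w - z)) a b (-L) := by
  simpa only [HasValue, ← div_neg, neg_sub] using Filter.Tendsto.neg h

end Kernels

/-- `∫ f(x) ρ(x) dx / (x + y)` over the positive half-line: the first transform of `f` at `-y`, up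
to the sign. -/
def stieltjesTransform (ρ : ℝ → ℝ) (f : ℝ[X]) (y : ℝ) : ℝ :=
  ∫ x in Set.Ioi (0 : ℝ), f.eval x * ρ x / (x + y)

section CorrelationKernels

variable {α β ρ : ℝ → ℝ} {p q : ℕ → ℝ[X]} {N : ℕ} {x y : ℝ}

theorem transform_one_neg_ofReal (ρ : ℝ → ℝ) (f : ℝ[X]) (y : ℝ) :
    transform ρ f 1 (-y : ℂ) = -(stieltjesTransform ρ f y : ℂ) := by
  rw [transform, stieltjesTransform, ← integral_complex_ofReal, ← integral_neg]
  congr with x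
  rw [Complex.ofReal_div, Complex.ofReal_add, ← div_neg, neg_add_rev, sub_eq_add_neg]

theorem transform_zero_ofReal (ρ : ℝ → ℝ) (f : ℝ[X]) (x : ℝ) :
    transform ρ f 0 (x : ℂ) = (f.eval x : ℝ) := by
  rw [transform_zero, ← eval_complexify, eval_complexify_ofReal]

theorem integrableOn_stieltjesTransform (hm : HasMoments fun t => (ρ t : ℂ)) (f : ℝ[X])
    (hy : 0 < y) : IntegrableOn (fun x => f.eval x * ρ x / (x + y)) (Set.Ioi 0) := by
  have hint : Integrable fun x => f.eval x * ρ x := by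
    simpa [eval_complexify_ofReal] using (hm.polynomial_mul (complexify f)).integrable.re
  have hinv : ∀ᵐ x ∂volume.restrict (Set.Ioi (0 : ℝ)), ‖(x + y)⁻¹‖ ≤ y⁻¹ := by
    filter_upwards [ae_restrict_mem measurableSet_Ioi] with x hx
    have hx : 0 < x := hx
    rw [norm_inv, Real.norm_of_nonneg (by positivity)]
    gcongr
    linarith
  exact hint.integrableOn.mul_bdd (Measurable.aestronglyMeasurable (by fun_prop)) hinv

theorem H10_eq_sum (hm : HasMoments fun t => (α t : ℂ)) (hx : 0 < x) (y : ℝ) :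
    H10 α p q N x y =
      ∑ j ∈ Finset.range N, (q j).eval y * stieltjesTransform α (p j) x := by
  simp only [stieltjesTransform, ← integral_const_mul]
  rw [← integral_finsetSum _ fun j _ =>
    (integrableOn_stieltjesTransform hm (p j) hx).const_mul _, H10]
  congr with t
  rw [H00, Finset.sum_mul, Finset.sum_div]
  exact Finset.sum_congr rfl fun j _ => by ring

theorem H01_eq_sum (hm : HasMoments fun t => (β t : ℂ)) (x : ℝ) (hy : 0 < y) :
    H01 β p q N x y =
      ∑ j ∈ Finset.range N, (p j).eval x * stieltjesTransform β (q j) y := by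
  simp only [stieltjesTransform, ← integral_const_mul]
  rw [← integral_finsetSum _ fun j _ =>
    (integrableOn_stieltjesTransform hm (q j) hy).const_mul _, H01]
  congr with t
  rw [H00, Finset.sum_mul, Finset.sum_div, add_comm y]
  exact Finset.sum_congr rfl fun j _ => by ring

theorem H11_eq_sum (hα : HasMoments fun t => (α t : ℂ)) (hβ : HasMoments fun t => (β t : ℂ))
    (hy : 0 < y) (hx : 0 < x) :
    H11 α β p q N y x =
      ∑ j ∈ Finset.range N, stieltjesTransform α (p j) y * stieltjesTransform β (q j) x
        - 1 / (x + y) := by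
  have hinner (z : ℝ) : ∫ w in Set.Ioi (0 : ℝ), H00 p q N z w * (α z * β w) / ((z + y) * (x + w))
      = ∑ j ∈ Finset.range N, (p j).eval z * α z / (z + y) * stieltjesTransform β (q j) x := by
    have hfactor : ∫ w in Set.Ioi (0 : ℝ), H00 p q N z w * (α z * β w) / ((z + y) * (x + w)) =
        α z / (z + y) * H01 β p q N z x := by
      rw [H01, ← integral_const_mul]
      congr with w
      rw [div_mul_div_comm]
      ring
    rw [hfactor, H01_eq_sum hβ z hx, Finset.mul_sum]
    exact Finset.sum_congr rfl fun j _ => by ring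
  rw [H11]
  simp only [hinner]
  rw [integral_finsetSum _ fun j _ =>
    (integrableOn_stieltjesTransform hα (p j) hy).mul_const _]
  simp only [integral_mul_const, stieltjesTransform]

theorem ofReal_H00 (α β : ℝ → ℝ) (x y : ℝ) :
    (H00 p q N x y : ℂ) = matrixKernel α β p q N x y 0 0 := by
  simp [H00, matrixKernel, transform_zero_ofReal, mul_comm]

theorem ofReal_H10 (β : ℝ → ℝ) (hm : HasMoments fun t => (α t : ℂ)) (hx : 0 < x) (y : ℝ) :
    (H10 α p q N x y : ℂ) = -matrixKernel α β p q N (-x) y 0 1 := by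
  simp [H10_eq_sum hm hx, matrixKernel, transform_zero_ofReal, transform_one_neg_ofReal]

theorem ofReal_H01 (α : ℝ → ℝ) (hm : HasMoments fun t => (β t : ℂ)) (x : ℝ) (hy : 0 < y) :
    (H01 β p q N x y : ℂ) = -matrixKernel α β p q N x (-y) 1 0 := by
  simp [H01_eq_sum hm x hy, matrixKernel, transform_zero_ofReal, transform_one_neg_ofReal, mul_comm]

theorem ofReal_H11 (hα : HasMoments fun t => (α t : ℂ)) (hβ : HasMoments fun t => (β t : ℂ))
    (hy : 0 < y) (hx : 0 < x) :
    (H11 α β p q N y x : ℂ) = matrixKernel α β p q N (-y) (-x) 1 1 := by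
  have hsign : 1 / (-(y : ℂ) + -x) = -(1 / ((x : ℂ) + y)) := by
    rw [← neg_add, add_comm, one_div_neg_eq_neg_one_div]
  simp [-one_div, H11_eq_sum hα hβ hy hx, matrixKernel, transform_one_neg_ofReal, mul_comm, hsign,
    sub_eq_add_neg]

end CorrelationKernels

end

end CauchyTwoMatrix

open CauchyTwoMatrix in
theorem mainTheorem3 (α β : ℝ → ℝ) (hαβ : IsDensityPair α β)
    (p q : ℕ → Polynomial ℝ) (hpq : IsCauchyBOP α β p q)
    (N : ℕ) (Γ : ℂ → Matrix (Fin 3) (Fin 3) ℂ) (hΓ : IsRHPSolution α β N Γ) :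
    (∀ x y : ℝ, 0 < x → 0 < y →
      (H00 p q N x y : ℂ) = matrixKernel α β p q N x y 0 0 ∧
      HasValue α β (fun z w => ((Γ w)⁻¹ * Γ z) 2 0 / (z - w)) x (-y) (H00 p q N x y)) ∧
    (∀ y' y : ℝ, 0 < y' → 0 < y →
      (H10 α p q N y' y : ℂ) = -matrixKernel α β p q N (-y') y 0 1 ∧
      HasValue α β (fun z w => ((Γ w)⁻¹ * Γ z) 2 1 / (w - z)) (-y') (-y) (H10 α p q N y' y)) ∧
    (∀ x x' : ℝ, 0 < x → 0 < x' →
      (H01 β p q N x x' : ℂ) = -matrixKernel α β p q N x (-x') 1 0 ∧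
      HasValue α β (fun z w => ((Γ w)⁻¹ * Γ z) 1 0 / (w - z)) x x' (H01 β p q N x x')) ∧
    (∀ y x : ℝ, 0 < y → 0 < x →
      (H11 α β p q N y x : ℂ) = matrixKernel α β p q N (-y) (-x) 1 1 ∧
      HasValue α β (fun z w => ((Γ w)⁻¹ * Γ z) 1 1 / (z - w)) (-y) x (H11 α β p q N y x)) := by
  have hα := hαβ.hasMoments_left hpq.right_not_ae_zero
  have hβ := hαβ.symm.hasMoments_left hpq.left_not_ae_zero
  refine ⟨fun x y _ _ => ⟨ofReal_H00 α β x y, ?_⟩,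
    fun y' y hy' _ => ⟨ofReal_H10 β hα hy' y, ?_⟩,
    fun x x' _ hx' => ⟨ofReal_H01 α hβ x hx', ?_⟩,
    fun y x hy hx => ⟨ofReal_H11 hα hβ hy hx, ?_⟩⟩
  · rw [ofReal_H00 α β x y]
    exact hΓ.hasValue_matrixKernel hαβ hpq 0 0 (by simp) (by simp)
  · rw [ofReal_H10 β hα hy' y, ← Complex.ofReal_neg]
    exact (hΓ.hasValue_matrixKernel hαβ hpq 0 1 (by simpa) (by simp)).neg_div_sub
  · rw [ofReal_H01 α hβ x hx', ← Complex.ofReal_neg, ← neg_neg (x' : ℂ), ← Complex.ofReal_neg]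
    exact (hΓ.hasValue_matrixKernel hαβ hpq 1 0 (by simp) (by simpa)).neg_div_sub
  · rw [ofReal_H11 hα hβ hy hx, ← Complex.ofReal_neg, ← Complex.ofReal_neg,
      ← neg_neg (x : ℂ), ← Complex.ofReal_neg]
    exact hΓ.hasValue_matrixKernel hαβ hpq 1 1 (by simpa) (by simpa)
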